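/- **Definitions.** Let $k_0<k_1<k_2<\cdots$ be a strictly increasing sequence of natural numbers with $k_n\mid k_{n+1}$ for all $n$. The associated $\mathbb Z$-odometer is the inverse limit $\varprojlim_n \mathbb Z/k_n\mathbb Z$ along the reduction maps, equipped with the inverse limit of the uniform probability measures (that is, the Haar probability measure), on which $m\in\mathbb Z$ acts by adding $m$ in every coordinate; this is a free probability-measure-preserving action. Let $\mathbb Z\curvearrowright (X,\mu)$ and $\mathbb Z\curvearrowright (Y,\nu)$ be two free probability-measure-preserving actions, written $(g,x)\mapsto g\cdot x$. An orbit equivalence is a measure isomorphism $\phi\colon X\to Y$ (modulo null sets) such that $\phi(\mathbb Z\cdot x)=\mathbb Z\cdot\phi(x)$ for almost every $x\in X$. Its cocycles $\lambda_\phi\colon\mathbb Z\times X\to\mathbb Z$ and $\kappa_\phi\colon\mathbb Z\times Y\to\mathbb Z$ are defined almost everywhere by $\phi(g\cdot x)=\lambda_\phi(g,x)\cdot\phi(x)$ and $\phi^{-1}(h\cdot y)=\kappa_\phi(h,y)\cdot\phi^{-1}(y)$. Let $\omega\colon\mathbb Z_{\ge 0}\to\mathbb R_{\ge 0}$ be non-decreasing.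 We say that $\phi$ is an $\omega$-orbit equivalence if for all $g,h\in\mathbb Z$ there are real constants $c_g,c_h>0$ with $$\int_X \omega\bigl(\lceil |\lambda_\phi(g,x)|/c_g\rceil\bigr)\,d\mu(x)<\infty\quad\text{and}\quad \int_Y \omega\bigl(\lceil |\kappa_\phi(h,y)|/c_h\rceil\bigr)\,d\nu(y)<\infty,$$ and that the two actions are $\omega$-orbit equivalent if such a $\phi$ exists. The function $\omega$ is sublinear if $\lim_{n\to\infty}\omega(n)/n=0$. The two actions are sub-$L^1$-orbit equivalent if they are $\omega$-orbit equivalent for every non-decreasing sublinear $\omega\colon\mathbb Z_{\ge 0}\to\mathbb R_{\ge 0}$. **Theorem.** Let $\mathbb Z\curvearrowright (X,\mu)$ and $\mathbb Z\curvearrowright (Y,\nu)$ be any two $\mathbb Z$-odometers. 1. For every non-decreasing sublinear function $\omega\colon\mathbb Z_{\ge 0}\to\mathbb R_{\ge 0}$ the two odometers are $\omega$-orbit equivalent. Moreover, for every $\delta>0$ there is an $\omega$-orbit equivalence $\phi\colon X\to Y$ such that the $\omega$-norms of both cocycles at the canonical generator $1\in\mathbb Z$ satisfy $$\int_X \omega\bigl(|\lambda_\phi(1,x)|\bigr)\,d\mu(x)<\omega(1)+\delta\quad\text{and}\quad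 \int_Y \omega\bigl(|\kappa_\phi(1,y)|\bigr)\,d\nu(y)<\omega(1)+\delta .$$ 2. Consequently, any two $\mathbb Z$-odometers are sub-$L^1$-orbit equivalent. -/

import Mathlib

open MeasureTheory Filter Topology
open scoped NNReal ENNReal

namespace QOE

/-! ### Quantitative orbit equivalence of actions of `ℤ` -/

section OrbitEquivalence

/-- A measure isomorphism `X → Y`: a measure-preserving map with a measure-preserving
almost everywhere defined inverse.  As usual, everything is considered up to null sets. -/
structure MeasureIso {X Y : Type*} [MeasurableSpace X] [MeasurableSpace Y]
    (μ : Measure X) (ν : Measure Y) where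
  toFun : X → Y
  invFun : Y → X
  measurePreserving_toFun : MeasurePreserving toFun μ ν
  measurePreserving_invFun : MeasurePreserving invFun ν μ
  left_inv : ∀ᵐ x ∂μ, invFun (toFun x) = x
  right_inv : ∀ᵐ y ∂ν, toFun (invFun y) = y

/-- The cocycle of a map `f : X → Y` sending `ℤ`-orbits to `ℤ`-orbits: `cocycle f g x` is the
integer `h` with `f (g x) = h (f x)`.  It is unique if the action on `Y` is free; the value is
irrelevant at those points `x` where no such `h` exists. -/
noncomputable def cocycle {X Y : Type*} [AddAction ℤ X] [AddAction ℤ Y]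
    (f : X → Y) (g : ℤ) (x : X) : ℤ :=
  Classical.epsilon fun h : ℤ => f (g +ᵥ x) = h +ᵥ f x

/-- The `ω`-norm `∫ ω(|l(x)|) dμ(x)` of a map `l : X → ℤ`. -/
noncomputable def omegaNorm {X : Type*} [MeasurableSpace X]
    (μ : Measure X) (ω : ℕ → ℝ≥0) (l : X → ℤ) : ℝ≥0∞ :=
  ∫⁻ x, (ω (l x).natAbs : ℝ≥0∞) ∂μ

variable {X Y : Type*} [MeasurableSpace X] [MeasurableSpace Y] [AddAction ℤ X] [AddAction ℤ Y]
  {μ : Measure X} {ν : Measure Y}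

/-- `φ` is an orbit equivalence: `φ(ℤ x) = ℤ φ(x)` for almost every `x`. -/
def MeasureIso.IsOrbitEquivalence (φ : MeasureIso μ ν) : Prop :=
  ∀ᵐ x ∂μ, φ.toFun '' AddAction.orbit ℤ x = AddAction.orbit ℤ (φ.toFun x)

/-- `φ` is an orbit equivalence whose cocycles `λ` (of `φ`) and `κ` (of `φ⁻¹`) satisfy
`∫ ω₁(|λ(g,x)| / c_g) dx < ∞` and `∫ ω₂(|κ(h,y)| / c_h) dy < ∞` for suitable constants
`c_g, c_h > 0`.  Word length in `ℤ` is taken with respect to the canonical generator.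
As `ωᵢ` is only defined on the non-negative integers, the quotient is rounded up. -/
def MeasureIso.IsOmegaOrbitEquivalence (φ : MeasureIso μ ν) (ω₁ ω₂ : ℕ → ℝ≥0) : Prop :=
  φ.IsOrbitEquivalence ∧
  (∀ g : ℤ, ∃ c : ℝ, 0 < c ∧
    ∫⁻ x, (ω₁ ⌈((cocycle φ.toFun g x).natAbs : ℝ) / c⌉₊ : ℝ≥0∞) ∂μ < ∞) ∧
  (∀ h : ℤ, ∃ c : ℝ, 0 < c ∧
    ∫⁻ y, (ω₂ ⌈((cocycle φ.invFun h y).natAbs : ℝ) / c⌉₊ : ℝ≥0∞) ∂ν < ∞)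

variable (μ ν)

/-- The actions of `ℤ` on `(X, μ)` and `(Y, ν)` are `ω`-orbit equivalent. -/
def OmegaOrbitEquivalent (ω : ℕ → ℝ≥0) : Prop :=
  ∃ φ : MeasureIso μ ν, φ.IsOmegaOrbitEquivalence ω ω

/-- `ω` is sublinear: `ω(n) / n → 0`. -/
def Sublinear (ω : ℕ → ℝ≥0) : Prop :=
  Tendsto (fun n : ℕ => (ω n : ℝ) / (n : ℝ)) atTop (𝓝 0)

/-- The actions of `ℤ` on `(X, μ)` and `(Y, ν)` are sub-`L¹`-orbit equivalent: they are
`ω`-orbit equivalent for every non-decreasing sublinear `ω`. -/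
def SubL1OrbitEquivalent : Prop :=
  ∀ ω : ℕ → ℝ≥0, Monotone ω → Sublinear ω → OmegaOrbitEquivalent μ ν ω

end OrbitEquivalence

/-! ### Odometers -/

/-- A (strictly) increasing sequence of natural numbers, each dividing the next. -/
structure OdometerSeq where
  k : ℕ → ℕ
  strictMono : StrictMono k
  dvd : ∀ n, k n ∣ k (n + 1)

namespace OdometerSeq

variable (a : OdometerSeq)

theorem pos (n : ℕ) : 0 < a.k n := by
  rcases Nat.eq_zero_or_pos (a.k n) with h | h
  · have h1 := a.strictMono (Nat.lt_succ_self n)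
    have h2 := a.dvd n
    rw [h] at h2
    have h3 := Nat.eq_zero_of_zero_dvd h2
    simp only [Nat.succ_eq_add_one] at h1
    omega
  · exact h

instance (n : ℕ) : NeZero (a.k n) := ⟨(a.pos n).ne'⟩

/-- The inverse limit of the rings `ℤ/k_n ℤ` along reduction modulo `k_n`, inside their product. -/
def invLimit : Subring (∀ n, ZMod (a.k n)) where
  carrier := {x | ∀ n, ZMod.castHom (a.dvd n) (ZMod (a.k n)) (x (n + 1)) = x n}
  mul_mem' := fun hx hy n => by
    rw [Pi.mul_apply, map_mul, hx n, hy n, Pi.mul_apply]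
  one_mem' := fun n => by rw [Pi.one_apply, map_one, Pi.one_apply]
  add_mem' := fun hx hy n => by
    rw [Pi.add_apply, map_add, hx n, hy n, Pi.add_apply]
  zero_mem' := fun n => by rw [Pi.zero_apply, map_zero, Pi.zero_apply]
  neg_mem' := fun hx n => by rw [Pi.neg_apply, map_neg, hx n, Pi.neg_apply]

/-- The underlying space of the odometer, with the topology and the Borel `σ`-algebra inherited
from the product of the finite discrete spaces `ℤ/k_n ℤ`. -/
abbrev Odometer : Type := a.invLimit

/-- The projection to the finite factor `ℤ/k_n ℤ`. -/
def proj (n : ℕ) (x : a.Odometer) : ZMod (a.k n) := x.1 n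

theorem isClosed_invLimit : IsClosed (a.invLimit : Set (∀ n, ZMod (a.k n))) := by
  have : (a.invLimit : Set (∀ n, ZMod (a.k n))) =
      ⋂ n, {x | ZMod.castHom (a.dvd n) (ZMod (a.k n)) (x (n + 1)) = x n} := by
    ext x
    simp only [Set.mem_iInter]
    rfl
  rw [this]
  refine isClosed_iInter fun n => isClosed_eq ?_ (continuous_apply n)
  exact (continuous_of_discreteTopology (f := ZMod.castHom (a.dvd n) (ZMod (a.k n)))).comp
    (continuous_apply (n + 1))

instance : CompactSpace a.Odometer :=
  isCompact_iff_compactSpace.mp a.isClosed_invLimit.isCompact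

/-- The action of `ℤ`: the integer `m` acts by adding `m` in every coordinate. -/
instance : AddAction ℤ a.Odometer where
  vadd m x := (m : a.Odometer) + x
  zero_vadd x := by
    change ((0 : ℤ) : a.Odometer) + x = x
    rw [Int.cast_zero, zero_add]
  add_vadd m n x := by
    change ((m + n : ℤ) : a.Odometer) + x = (m : a.Odometer) + ((n : a.Odometer) + x)
    rw [Int.cast_add, add_assoc]

/-- The measure of the odometer: the translation invariant probability measure.  It is the
inverse limit of the uniform probability measures, see `map_proj_measure`. -/
noncomputable def measure : Measure a.Odometer :=
  Measure.addHaarMeasure ⊤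

instance : a.measure.IsAddLeftInvariant := by
  unfold measure; infer_instance

instance : IsProbabilityMeasure a.measure :=
  ⟨Measure.addHaarMeasure_self (K₀ := (⊤ : TopologicalSpace.PositiveCompacts a.Odometer))⟩

theorem proj_vadd (n : ℕ) (m : ℤ) (x : a.Odometer) :
    a.proj n (m +ᵥ x) = (m : ZMod (a.k n)) + a.proj n x := by
  change ((m : a.Odometer) + x).1 n = _
  simp [proj]

theorem measurable_proj (n : ℕ) : Measurable (a.proj n) :=
  (measurable_pi_apply n).comp measurable_subtype_coe

/-- The projection to `ℤ/k_n ℤ` maps the measure of the odometer to the uniform probability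
measure. -/
theorem map_proj_measure (n : ℕ) :
    a.measure.map (a.proj n) = ProbabilityTheory.uniformOn Set.univ := by
  have hp : IsProbabilityMeasure (a.measure.map (a.proj n)) :=
    Measure.isProbabilityMeasure_map (a.measurable_proj n).aemeasurable
  have h0 : ∀ z : ZMod (a.k n),
      a.measure.map (a.proj n) {z} = a.measure.map (a.proj n) {0} := fun z => by
    obtain ⟨m, rfl⟩ := ZMod.intCast_surjective z
    rw [Measure.map_apply (a.measurable_proj n) (measurableSet_singleton _),
      Measure.map_apply (a.measurable_proj n) (measurableSet_singleton _),
      ← measure_preimage_add a.measure (m : a.Odometer)]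
    congr 1
    ext x
    change a.proj n (m +ᵥ x) = (m : ZMod (a.k n)) ↔ a.proj n x = 0
    rw [proj_vadd, add_eq_left]
  have h1 : (a.k n : ℝ≥0∞) * a.measure.map (a.proj n) {0} = 1 := by
    rw [← measure_univ (μ := a.measure.map (a.proj n)), ← Finset.coe_univ,
      ← sum_measure_singleton, Finset.sum_congr rfl fun z _ => h0 z]
    simp [ZMod.card]
  refine Measure.ext_of_singleton fun z => ?_
  rw [h0 z, ProbabilityTheory.uniformOn_univ, Measure.count_singleton, ZMod.card, one_div]
  exact ENNReal.eq_inv_of_mul_eq_one_left (by rw [mul_comm]; exact h1)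

/-- The action of `ℤ` on the odometer is measure-preserving. -/
theorem measurePreserving_vadd (m : ℤ) :
    MeasurePreserving (fun x : a.Odometer => m +ᵥ x) a.measure a.measure :=
  measurePreserving_add_left a.measure (m : a.Odometer)

/-- The action of `ℤ` on the odometer is free. -/
theorem eq_zero_of_vadd_eq (m : ℤ) (x : a.Odometer) (h : m +ᵥ x = x) : m = 0 := by
  by_contra hm
  have h1 : ∀ n, a.k n ∣ m.natAbs := fun n => by
    have h2 := congrArg (a.proj n) h
    rw [proj_vadd, add_eq_right, ZMod.intCast_zmod_eq_zero_iff_dvd] at h2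
    exact Int.natCast_dvd.mp h2
  have h3 := Nat.le_of_dvd (Int.natAbs_pos.mpr hm) (h1 (m.natAbs + 1))
  have h4 := a.strictMono.le_apply (x := m.natAbs + 1)
  omega

end OdometerSeq

end QOE

/-!
The two odometers are realized as two orders on the orbits of a third one.

At each stage there is a block of `m = k * l` labels carrying two linear orders, where `k` divides
some `a_i` and `l` divides some `b_j` (`Block`).  In the first order the block is a union of
intervals of length `k`, in the second a union of intervals of length `l`.  To pass to a
longer block with first length `k' = a_i = q * m + k * s`, where `s < l`, take `l` intervals of
length `k'`, fill each of them with `q` intact copies of the block, and use the `l` leftovers of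
length `k * s` for `s` further copies, each of them cut into its `l` intervals of length `k`; in the
second order all copies are simply concatenated (`Block.ext`).  Then the roles of the two orders
are exchanged.  The label of a point in the long block, reduced modulo `m`, is its label in the copy
of the short block, so infinite sequences of labels are the points of the odometer of the sequence
`m_n`.  The positions in the first order modulo `a_i` and in the second order modulo `b_j`
stabilize, and define measure-preserving maps to the two given odometers (`Coding`).  Call a copy
exceptional if it is one of the `s` distributed ones or the last intact one in its interval of
length `k'`.  Both maps are injective on the conull set of points that lie in exceptional copies at
finitely many stages only, and the composition of one with the inverse of the other is the orbit
equivalence (`exists_measureIso_of_codings`).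

The successor of a point in one order is at distance `1` in the other one, except that a point in
one of the at most `2 * l` exceptional copies may be moved by up to `m' = k' * l`, and a point that
is last in a block by up to `2 * m` (`Coding.exists_succ`).  The exceptional points have proportion
at most `2 * l * m / m'` and the last ones proportion `1 / m`.  As `ω` is sublinear,
`ω m' * 2 * l * m / m'` and `ω (2 * m') / m'` are as small as desired once `k'` is large
(`Block.exists_extends`), and the contributions of all stages to the `ω`-norm at the generator add
up to less than `δ` (`Coding.lintegral_cost_lt`).  The cocycle at `g` is, up to sign, a sum of `|g|`
values of the cocycle at `1`, which yields the integrability for all `g`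
(`lintegral_cocycle_lt_top`).
-/

namespace QOE

/-! ### Orbit equivalences from pointwise information about the generator -/

section Orbits

variable {X Y : Type*} [AddAction ℤ X] [AddAction ℤ Y]

theorem exists_vadd_of_forall_one {f : X → Y} {x : X}
    (h : ∀ m : ℤ, ∃ j : ℤ, f ((1 : ℤ) +ᵥ (m +ᵥ x)) = j +ᵥ f (m +ᵥ x)) (m : ℤ) :
    ∃ j : ℤ, f (m +ᵥ x) = j +ᵥ f x := by
  induction m with
  | zero => exact ⟨0, by simp⟩
  | succ n ih =>
    obtain ⟨j, hj⟩ := ih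
    obtain ⟨i, hi⟩ := h n
    exact ⟨i + j, by rw [add_comm, add_vadd, hi, hj, add_vadd]⟩
  | pred n ih =>
    obtain ⟨j, hj⟩ := ih
    obtain ⟨i, hi⟩ := h (-n - 1)
    refine ⟨-i + j, ?_⟩
    rw [← add_vadd, show (1 + (-n - 1) : ℤ) = -n by ring, hj] at hi
    rw [add_vadd, hi, neg_vadd_vadd]

theorem cocycle_eq (hY : ∀ (m : ℤ) (y : Y), m +ᵥ y = y → m = 0) {f : X → Y} {g j : ℤ} {x : X}
    (h : f (g +ᵥ x) = j +ᵥ f x) : cocycle f g x = j := by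
  have h1 : f (g +ᵥ x) = cocycle f g x +ᵥ f x :=
    Classical.epsilon_spec (p := fun i : ℤ => f (g +ᵥ x) = i +ᵥ f x) ⟨j, h⟩
  have h2 : (-j + cocycle f g x) +ᵥ f x = f x := by
    rw [add_vadd, ← h1, h, neg_vadd_vadd]
  have := hY _ _ h2
  omega

/-- If every step `f (1 + (i + x))` is a displacement by `j` with `ω |j| ≤ D i`, then the
displacement over `n` steps is at most `n u` for some `u` with `ω u` bounded by some `D i`. -/
theorem exists_natAbs_le_mul {ω : ℕ → ℝ≥0} (hω : Monotone ω) {f : X → Y} {D : ℕ → ℝ≥0∞}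
    {x : X}
    (h : ∀ i : ℕ, ∃ j : ℤ, f ((1 : ℤ) +ᵥ ((i : ℤ) +ᵥ x)) = j +ᵥ f ((i : ℤ) +ᵥ x) ∧
      (ω j.natAbs : ℝ≥0∞) ≤ D i) (n : ℕ) :
    ∃ j : ℤ, f ((n : ℤ) +ᵥ x) = j +ᵥ f x ∧
      ∃ i ≤ n, ∃ u : ℕ, j.natAbs ≤ n * u ∧ (ω u : ℝ≥0∞) ≤ D i := by
  induction n with
  | zero =>
    obtain ⟨j, -, hj⟩ := h 0
    refine ⟨0, by simp, 0, le_rfl, 0, by simp, le_trans ?_ hj⟩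
    exact_mod_cast hω (Nat.zero_le _)
  | succ n ih =>
    obtain ⟨j, hj, i, hi, u, hju, hu⟩ := ih
    obtain ⟨j', hj', hu'⟩ := h n
    refine ⟨j' + j, ?_, ?_⟩
    · rw [Nat.cast_succ, add_comm, add_vadd, hj', hj, add_vadd]
    have h1 := Int.natAbs_add_le j' j
    rcases le_total u j'.natAbs with hle | hle
    · refine ⟨n, Nat.le_succ n, j'.natAbs, ?_, hu'⟩
      have := Nat.mul_le_mul_left n hle
      rw [Nat.succ_mul]
      omega
    · refine ⟨i, by omega, u, ?_, hu⟩
      rw [Nat.succ_mul]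
      omega

end Orbits

section General

variable {X Y : Type*} [MeasurableSpace X] [MeasurableSpace Y]
  {μ : Measure X} {ν : Measure Y}

/-- A measure-preserving map between standard Borel spaces which is injective on a conull set has
a measurable almost everywhere inverse, by the Lusin-Souslin theorem. -/
theorem exists_measurePreserving_leftInverse [StandardBorelSpace X] [StandardBorelSpace Y]
    {f : X → Y} (hf : MeasurePreserving f μ ν) {s : Set X} (hs : MeasurableSet s)
    (hs' : ∀ᵐ x ∂μ, x ∈ s) (hinj : Set.InjOn f s) (hX : Nonempty X) :
    ∃ g : Y → X, MeasurePreserving g ν μ ∧ (∀ x ∈ s, g (f x) = x) ∧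
      ∀ t ⊆ s, (∀ᵐ x ∂μ, x ∈ t) → MeasurableSet t → ∀ᵐ y ∂ν, y ∈ f '' t := by
  have := hs.standardBorel
  have he : MeasurableEmbedding (fun x : s => f x) :=
    (hf.measurable.comp measurable_subtype_coe).measurableEmbedding
      fun x y h => Subtype.ext (hinj x.2 y.2 h)
  obtain ⟨g, hg, hgf⟩ := he.exists_measurable_extend (measurable_subtype_coe (p := (· ∈ s)))
    fun _ => hX
  have hg' : ∀ x ∈ s, g (f x) = x := fun x hx => congrFun hgf ⟨x, hx⟩
  refine ⟨g, ⟨hg, ?_⟩, hg', fun t ht ht' htm => ?_⟩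
  · rw [← hf.map_eq, Measure.map_map hg hf.measurable,
      Measure.map_congr (f := g ∘ f) (g := id) (hs'.mono fun x hx => hg' x hx), Measure.map_id]
  · rw [← hf.map_eq]
    refine (ae_map_iff hf.measurable.aemeasurable
      (htm.image_of_measurable_injOn hf.measurable (hinj.mono ht))).2 ?_
    exact ht'.mono fun x hx => ⟨x, hx, rfl⟩

variable [AddAction ℤ X] [AddAction ℤ Y]

theorem ae_forall_vadd (hX : ∀ m : ℤ, MeasurePreserving (fun x : X => m +ᵥ x) μ μ)
    {p : X → Prop} (h : ∀ᵐ x ∂μ, p x) : ∀ᵐ x ∂μ, ∀ m : ℤ, p (m +ᵥ x) :=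
  ae_all_iff.2 fun m => (hX m).quasiMeasurePreserving.ae h

/-- If a measure isomorphism and its inverse send the point `1 + x` to the orbit of the image of
`x`, for almost every `x`, then it is an orbit equivalence. -/
theorem MeasureIso.isOrbitEquivalence_of_one
    (hX : ∀ m : ℤ, MeasurePreserving (fun x : X => m +ᵥ x) μ μ)
    (hY : ∀ m : ℤ, MeasurePreserving (fun y : Y => m +ᵥ y) ν ν) (φ : MeasureIso μ ν)
    (h₁ : ∀ᵐ x ∂μ, ∃ j : ℤ, φ.toFun ((1 : ℤ) +ᵥ x) = j +ᵥ φ.toFun x)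
    (h₂ : ∀ᵐ y ∂ν, ∃ j : ℤ, φ.invFun ((1 : ℤ) +ᵥ y) = j +ᵥ φ.invFun y) :
    φ.IsOrbitEquivalence := by
  have hr := φ.measurePreserving_toFun.quasiMeasurePreserving.ae (ae_forall_vadd hY φ.right_inv)
  have h₂' := φ.measurePreserving_toFun.quasiMeasurePreserving.ae (ae_forall_vadd hY h₂)
  filter_upwards [ae_forall_vadd hX h₁, φ.left_inv, hr, h₂'] with x hx hl hr hx'
  refine Set.Subset.antisymm ?_ ?_
  · rintro _ ⟨_, ⟨m, rfl⟩, rfl⟩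
    obtain ⟨j, hj⟩ := exists_vadd_of_forall_one hx m
    exact ⟨j, hj.symm⟩
  · rintro _ ⟨m, rfl⟩
    obtain ⟨j, hj⟩ := exists_vadd_of_forall_one hx' m
    refine ⟨j +ᵥ x, ⟨j, rfl⟩, ?_⟩
    rw [hl] at hj
    rw [← hj]
    exact hr m

end General

section Cocycle

variable {X Y : Type*} [MeasurableSpace X] {μ : Measure X} [AddAction ℤ X] [AddAction ℤ Y]

/-- A bound for the cocycle at the generator `1` gives integrability of the cocycle at every
`g`, after rescaling by `|g| + 1`. -/
theorem lintegral_cocycle_lt_top {ω : ℕ → ℝ≥0} (hω : Monotone ω)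
    (hX : ∀ m : ℤ, MeasurePreserving (fun x : X => m +ᵥ x) μ μ)
    (hY : ∀ (m : ℤ) (y : Y), m +ᵥ y = y → m = 0) {f : X → Y} {D : X → ℝ≥0∞}
    (hD : Measurable D) (hD' : ∫⁻ x, D x ∂μ < ∞)
    (h : ∀ᵐ x ∂μ, ∃ j : ℤ, f ((1 : ℤ) +ᵥ x) = j +ᵥ f x ∧ (ω j.natAbs : ℝ≥0∞) ≤ D x) (g : ℤ) :
    ∃ c : ℝ, 0 < c ∧
      ∫⁻ x, (ω ⌈((cocycle f g x).natAbs : ℝ) / c⌉₊ : ℝ≥0∞) ∂μ < ∞ := by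
  refine ⟨g.natAbs + 1, by positivity, ?_⟩
  have key : ∀ᵐ x ∂μ, (ω ⌈((cocycle f g x).natAbs : ℝ) / (g.natAbs + 1)⌉₊ : ℝ≥0∞) ≤
      ∑ i ∈ Finset.Icc (-|g|) |g|, D (i +ᵥ x) := by
    filter_upwards [ae_forall_vadd hX h] with x hx
    -- It suffices to bound the cocycle by a multiple of some `u` with `ω u` under control.
    suffices H : ∃ u : ℕ, (cocycle f g x).natAbs ≤ g.natAbs * u ∧
        ∃ i : ℤ, -|g| ≤ i ∧ i ≤ |g| ∧ (ω u : ℝ≥0∞) ≤ D (i +ᵥ x) by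
      obtain ⟨u, hu, i, hi, hi', hui⟩ := H
      refine le_trans ?_ (hui.trans (Finset.single_le_sum (f := fun i : ℤ => D (i +ᵥ x))
        (fun _ _ => zero_le) (Finset.mem_Icc.2 ⟨hi, hi'⟩)))
      refine ENNReal.coe_le_coe.2 (hω (Nat.ceil_le.2 ?_))
      rw [div_le_iff₀ (by positivity)]
      have : ((cocycle f g x).natAbs : ℝ) ≤ g.natAbs * u := by exact_mod_cast hu
      have hu0 : (0 : ℝ) ≤ u := by positivity
      linarith
    rcases le_total 0 g with hg | hg
    · obtain ⟨n, rfl⟩ := Int.eq_ofNat_of_zero_le hg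
      obtain ⟨j, hj, i, hi, u, hju, hu⟩ :=
        exists_natAbs_le_mul (D := fun i => D ((i : ℤ) +ᵥ x)) hω (fun i => hx i) n
      rw [cocycle_eq hY hj]
      refine ⟨u, by simpa using hju, i, ?_, ?_, hu⟩ <;> rw [abs_of_nonneg hg] <;> omega
    · obtain ⟨n, hn⟩ := Int.eq_ofNat_of_zero_le (neg_nonneg.2 hg)
      obtain rfl : g = -n := by omega
      obtain ⟨j, hj, i, hi, u, hju, hu⟩ :=
        exists_natAbs_le_mul (D := fun i : ℕ => D ((i + -n : ℤ) +ᵥ x)) (x := -(n : ℤ) +ᵥ x) hω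
          (fun i => by simpa only [add_vadd] using hx (i + -n)) n
      have hj' : f (-(n : ℤ) +ᵥ x) = -j +ᵥ f x := by
        rw [vadd_neg_vadd] at hj
        rw [hj, neg_vadd_vadd]
      rw [cocycle_eq hY hj']
      refine ⟨u, by simpa using hju, i + -n, ?_, ?_, hu⟩ <;> rw [abs_of_nonpos hg] <;> omega
  refine (lintegral_mono_ae key).trans_lt ?_
  rw [lintegral_finsetSum (f := fun i x => D (i +ᵥ x)) _ fun i _ => hD.comp (hX i).measurable]
  refine ENNReal.sum_lt_top.2 fun i _ => ?_
  rwa [(hX i).lintegral_comp hD]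

theorem omegaNorm_cocycle_le {ω : ℕ → ℝ≥0}
    (hY : ∀ (m : ℤ) (y : Y), m +ᵥ y = y → m = 0) {f : X → Y} {D : X → ℝ≥0∞}
    (h : ∀ᵐ x ∂μ, ∃ j : ℤ, f ((1 : ℤ) +ᵥ x) = j +ᵥ f x ∧ (ω j.natAbs : ℝ≥0∞) ≤ D x) :
    omegaNorm μ ω (cocycle f 1) ≤ ∫⁻ x, D x ∂μ := by
  refine lintegral_mono_ae (h.mono fun x ⟨j, hj, hD⟩ => ?_)
  rwa [cocycle_eq hY hj]

end Cocycle

namespace OdometerSeq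

/-! ### Measure and residues on an odometer -/

variable (a : OdometerSeq)

instance : StandardBorelSpace a.Odometer :=
  a.isClosed_invLimit.measurableSet.standardBorel

theorem dvd_of_le {i j : ℕ} (h : i ≤ j) : a.k i ∣ a.k j :=
  Nat.le_induction (dvd_refl _) (fun n _ ih => ih.trans (a.dvd n)) j h

theorem le_k (n : ℕ) : n ≤ a.k n := a.strictMono.le_apply

/-- The residue of a point of the odometer modulo `k_n`, as a natural number below `k_n`. -/
def res (n : ℕ) (x : a.Odometer) : ℕ := (a.proj n x).val

theorem res_lt (n : ℕ) (x : a.Odometer) : a.res n x < a.k n := ZMod.val_lt _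

theorem natCast_res (n : ℕ) (x : a.Odometer) : (a.res n x : ZMod (a.k n)) = a.proj n x :=
  ZMod.natCast_zmod_val _

theorem proj_succ (n : ℕ) (x : a.Odometer) :
    ZMod.castHom (a.dvd n) (ZMod (a.k n)) (a.proj (n + 1) x) = a.proj n x := x.2 n

theorem res_succ_mod (n : ℕ) (x : a.Odometer) : a.res (n + 1) x % a.k n = a.res n x := by
  have h := a.proj_succ n x
  rw [← natCast_res, map_natCast] at h
  change _ = (a.proj n x).val
  rw [← h, ZMod.val_natCast]

theorem proj_natCast_of_le {i j : ℕ} (hij : i ≤ j) (x : a.Odometer) :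
    (a.res j x : ZMod (a.k i)) = a.proj i x := by
  induction j, hij using Nat.le_induction with
  | base => exact a.natCast_res i x
  | succ j hij ih =>
    rw [← ih, ← a.res_succ_mod j x, ZMod.natCast_eq_natCast_iff]
    exact ((Nat.mod_modEq _ _).of_dvd (a.dvd_of_le hij)).symm

theorem res_of_le {i j : ℕ} (hij : i ≤ j) (x : a.Odometer) :
    a.res j x % a.k i = a.res i x := by
  rw [← ZMod.val_natCast, a.proj_natCast_of_le hij, res]

theorem measurable_res (n : ℕ) : Measurable (a.res n) :=
  (measurable_of_countable (fun z : ZMod (a.k n) => z.val)).comp (a.measurable_proj n)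

variable {a}

theorem ext_proj {x y : a.Odometer} (h : ∀ n, a.proj n x = a.proj n y) : x = y :=
  Subtype.ext (funext h)

theorem ext_res_frequently {x y : a.Odometer} (h : ∃ᶠ n in atTop, a.res n x = a.res n y) :
    x = y := by
  refine ext_proj fun i => ?_
  obtain ⟨n, hin, hn⟩ := frequently_atTop.1 h i
  rw [← a.proj_natCast_of_le hin, hn, a.proj_natCast_of_le hin]

theorem res_vadd {n : ℕ} {x : a.Odometer} {d : ℤ} {r : ℕ} (h : (a.res n x : ℤ) + d = r)
    (hr : r < a.k n) : a.res n (d +ᵥ x) = r := by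
  have h1 : a.proj n (d +ᵥ x) = (r : ZMod (a.k n)) := by
    rw [proj_vadd, ← natCast_res, ← Int.cast_natCast (R := ZMod (a.k n)) (a.res n x),
      ← Int.cast_add, add_comm, h, Int.cast_natCast]
  rw [res, h1, ZMod.val_natCast, Nat.mod_eq_of_lt hr]

theorem measure_proj_eq (n : ℕ) (c : ZMod (a.k n)) :
    a.measure {x | a.proj n x = c} = (a.k n : ℝ≥0∞)⁻¹ := by
  have h := Measure.map_apply (μ := a.measure) (a.measurable_proj n) (measurableSet_singleton c)
  rw [map_proj_measure, ProbabilityTheory.uniformOn_univ, Measure.count_singleton, ZMod.card,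
    one_div] at h
  exact h.symm

theorem measure_res_mem_le (n : ℕ) (s : Finset ℕ) :
    a.measure {x | a.res n x ∈ s} ≤ s.card / a.k n := by
  have h1 : {x | a.res n x ∈ s} ⊆ ⋃ r ∈ s, {x | a.proj n x = (r : ZMod (a.k n))} := by
    intro x hx
    simp only [Set.mem_iUnion]
    exact ⟨_, hx, (a.natCast_res n x).symm⟩
  refine (measure_mono h1).trans ((measure_biUnion_finset_le _ _).trans ?_)
  simp_rw [measure_proj_eq]
  simp [div_eq_mul_inv]

/-- A probability measure on an odometer with uniform marginals is the Haar measure. -/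
theorem eq_measure_of_map_proj (ρ : Measure a.Odometer) [IsProbabilityMeasure ρ]
    (h : ∀ n, ρ.map (a.proj n) = ProbabilityTheory.uniformOn Set.univ) : ρ = a.measure := by
  have hmono : Monotone fun n => (⊤ : MeasurableSpace (ZMod (a.k n))).comap (a.proj n) := by
    refine monotone_nat_of_le_succ fun n => ?_
    rintro _ ⟨s, -, rfl⟩
    refine ⟨ZMod.castHom (a.dvd n) (ZMod (a.k n)) ⁻¹' s, trivial, ?_⟩
    ext x
    simp [← a.proj_succ n x]
  have hgen : (inferInstance : MeasurableSpace a.Odometer) =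
      ⨆ n, (⊤ : MeasurableSpace (ZMod (a.k n))).comap (a.proj n) := by
    change MeasurableSpace.comap _ (⨆ n, _) = _
    rw [MeasurableSpace.comap_iSup]
    simp_rw [MeasurableSpace.comap_comp]
    rfl
  refine ext_of_generate_finite
    (⋃ n, {t | MeasurableSet[(⊤ : MeasurableSpace (ZMod (a.k n))).comap (a.proj n)] t})
    (hgen.trans (MeasurableSpace.generateFrom_iUnion_measurableSet _).symm)
    (isPiSystem_iUnion_of_monotone _ (fun n => @MeasurableSpace.isPiSystem_measurableSet _ (_))
      fun i j hij => hmono hij) ?_ (by simp)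
  intro t ht
  obtain ⟨n, s, -, rfl⟩ := Set.mem_iUnion.1 ht
  have hs : MeasurableSet s := s.to_countable.measurableSet
  rw [← Measure.map_apply (a.measurable_proj n) hs, ← Measure.map_apply (a.measurable_proj n) hs,
    h, map_proj_measure]

end OdometerSeq

/-! ### Factor maps between odometers given by finite permutations -/

theorem eq_uniformOn_univ_of_forall_singleton {k : ℕ} [NeZero k] {ρ : Measure (ZMod k)}
    [IsProbabilityMeasure ρ] (h : ∀ c, ρ {c} = ρ {0}) :
    ρ = ProbabilityTheory.uniformOn Set.univ := by
  have h1 : (k : ℝ≥0∞) * ρ {0} = 1 := by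
    rw [← measure_univ (μ := ρ), ← Finset.coe_univ, ← sum_measure_singleton,
      Finset.sum_congr rfl fun z _ => h z]
    simp [ZMod.card]
  refine Measure.ext_of_singleton fun z => ?_
  rw [h z, ProbabilityTheory.uniformOn_univ, Measure.count_singleton, ZMod.card, one_div]
  exact ENNReal.eq_inv_of_mul_eq_one_left (by rw [mul_comm]; exact h1)

theorem map_uniformOn_univ_of_bijective {k : ℕ} [NeZero k] {e : ZMod k → ZMod k}
    (he : Function.Bijective e) :
    (ProbabilityTheory.uniformOn (Set.univ : Set (ZMod k))).map e =
      ProbabilityTheory.uniformOn Set.univ := by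
  refine Measure.ext_of_singleton fun c => ?_
  obtain ⟨d, rfl⟩ := he.2 c
  rw [Measure.map_apply (measurable_of_countable e) (measurableSet_singleton _)]
  have : e ⁻¹' {e d} = {d} := by
    ext x
    simp [he.1.eq_iff]
  rw [this, ProbabilityTheory.uniformOn_univ, ProbabilityTheory.uniformOn_univ,
    Measure.count_singleton, Measure.count_singleton]

theorem OdometerSeq.map_castHom_proj (a : OdometerSeq) {n j : ℕ} [NeZero j] (h : j ∣ a.k n) :
    (a.measure.map (a.proj n)).map (ZMod.castHom h (ZMod j)) =
      ProbabilityTheory.uniformOn Set.univ := by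
  have hf : Measurable (ZMod.castHom h (ZMod j)) := measurable_of_countable _
  rw [Measure.map_map hf (a.measurable_proj n)]
  have := Measure.isProbabilityMeasure_map (μ := a.measure)
    (hf.comp (a.measurable_proj n)).aemeasurable
  refine eq_uniformOn_univ_of_forall_singleton fun z => ?_
  obtain ⟨m, rfl⟩ := ZMod.intCast_surjective z
  rw [Measure.map_apply (hf.comp (a.measurable_proj n)) (measurableSet_singleton _),
    Measure.map_apply (hf.comp (a.measurable_proj n)) (measurableSet_singleton _),
    ← measure_preimage_add a.measure (m : a.Odometer)]
  congr 1
  ext x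
  change ZMod.castHom h (ZMod j) (a.proj n (m +ᵥ x)) = (m : ZMod j) ↔
    ZMod.castHom h (ZMod j) (a.proj n x) = 0
  rw [a.proj_vadd, map_add, map_intCast, add_eq_left]

/-- The data of a factor map from the odometer of `m` to the odometer of `a`.  A point with
residue `p` modulo `m_n` is regarded as sitting at position `σ n p` in a block of length `m_n`
of an orbit in the odometer of `a`; such a block is a union of full blocks of length `k n`, and
the position modulo `k n` does not change when passing to a longer block. -/
structure Coding (m a : OdometerSeq) where
  k : ℕ → ℕ
  σ : ℕ → ℕ → ℕ
  bijOn : ∀ n, Set.BijOn (σ n) (Set.Iio (m.k n)) (Set.Iio (m.k n))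
  k_dvd : ∀ n, k n ∣ k (n + 1)
  k_dvd_m : ∀ n, k n ∣ m.k n
  cofinal : ∀ i, ∃ n, a.k i ∣ k n
  modEq : ∀ n p, p < m.k (n + 1) → σ (n + 1) p ≡ σ n (p % m.k n) [MOD k n]

namespace Coding

variable {m a : OdometerSeq} (c : Coding m a)

/-- The position of `z` in its block of length `m_n`. -/
def pos (n : ℕ) (z : m.Odometer) : ℕ := c.σ n (m.res n z)

theorem pos_lt (n : ℕ) (z : m.Odometer) : c.pos n z < m.k n := (c.bijOn n).mapsTo (m.res_lt n z)

theorem measurable_pos (n : ℕ) : Measurable (c.pos n) :=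
  (measurable_of_countable (c.σ n)).comp (m.measurable_res n)

theorem k_dvd_of_le {i j : ℕ} (h : i ≤ j) : c.k i ∣ c.k j :=
  Nat.le_induction (dvd_refl _) (fun n _ ih => ih.trans (c.k_dvd n)) j h

theorem pos_modEq {i j : ℕ} (h : i ≤ j) (z : m.Odometer) : c.pos j z ≡ c.pos i z [MOD c.k i] := by
  induction j, h using Nat.le_induction with
  | base => rfl
  | succ j hij ih =>
    have := c.modEq j _ (m.res_lt (j + 1) z)
    rw [m.res_succ_mod] at this
    exact (this.of_dvd (c.k_dvd_of_le hij)).trans ih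

theorem natCast_pos_eq {i n n' : ℕ} (h : a.k i ∣ c.k n) (h' : a.k i ∣ c.k n') (z : m.Odometer) :
    (c.pos n z : ZMod (a.k i)) = c.pos n' z := by
  rw [ZMod.natCast_eq_natCast_iff]
  rcases le_total n n' with hn | hn
  · exact ((c.pos_modEq hn z).of_dvd h).symm
  · exact (c.pos_modEq hn z).of_dvd h'

/-- The factor map: modulo `a_i`, the image of `z` is the position of `z` in any block of length
`m_n` for `n` large. -/
noncomputable def toFun (z : m.Odometer) : a.Odometer :=
  ⟨fun i => (c.pos (c.cofinal i).choose z : ZMod (a.k i)), fun i => by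
    rw [map_natCast]
    exact c.natCast_pos_eq ((a.dvd i).trans (c.cofinal (i + 1)).choose_spec)
      (c.cofinal i).choose_spec z⟩

theorem proj_toFun {i n : ℕ} (h : a.k i ∣ c.k n) (z : m.Odometer) :
    a.proj i (c.toFun z) = c.pos n z :=
  c.natCast_pos_eq (c.cofinal i).choose_spec h z

theorem measurable_toFun : Measurable c.toFun :=
  (measurable_pi_lambda _ fun _ =>
    (measurable_of_countable (Nat.cast : ℕ → ZMod _)).comp (c.measurable_pos _)).subtype_mk

/-- The factor map is measure preserving, because its marginals are uniform. -/
theorem measurePreserving_toFun : MeasurePreserving c.toFun m.measure a.measure := by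
  refine ⟨c.measurable_toFun, ?_⟩
  have := Measure.isProbabilityMeasure_map (μ := m.measure) c.measurable_toFun.aemeasurable
  refine OdometerSeq.eq_measure_of_map_proj _ fun i => ?_
  obtain ⟨n, hn⟩ := c.cofinal i
  have hi := hn.trans (c.k_dvd_m n)
  -- The permutation `σ n` of the residues preserves the uniform measure.
  let e : ZMod (m.k n) → ZMod (m.k n) := fun x => (c.σ n x.val : ZMod (m.k n))
  have he : Function.Bijective e := by
    refine Finite.injective_iff_bijective.1 fun x y hxy => ?_
    have hx := (c.bijOn n).mapsTo (ZMod.val_lt x)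
    have hy := (c.bijOn n).mapsTo (ZMod.val_lt y)
    have h := (ZMod.natCast_eq_natCast_iff' _ _ _).1 hxy
    rw [Nat.mod_eq_of_lt hx, Nat.mod_eq_of_lt hy] at h
    exact ZMod.val_injective _ ((c.bijOn n).injOn (ZMod.val_lt x) (ZMod.val_lt y) h)
  have hcomp : a.proj i ∘ c.toFun = ZMod.castHom hi (ZMod (a.k i)) ∘ e ∘ m.proj n := by
    funext z
    simp only [Function.comp, e, map_natCast]
    exact c.proj_toFun hn z
  rw [Measure.map_map (a.measurable_proj i) c.measurable_toFun, hcomp,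
    ← Measure.map_map (measurable_of_countable _)
      ((measurable_of_countable e).comp (m.measurable_proj n)),
    ← Measure.map_map (measurable_of_countable e) (m.measurable_proj n), m.map_proj_measure,
    map_uniformOn_univ_of_bijective he, ← m.map_proj_measure, m.map_castHom_proj]

/-- Points whose positions eventually differ by `d` are mapped to points of one orbit. -/
theorem toFun_eq_vadd {z z' : m.Odometer} {d : ℤ}
    (h : ∀ᶠ n in atTop, (c.pos n z' : ℤ) = d + c.pos n z) : c.toFun z' = d +ᵥ c.toFun z := by
  refine OdometerSeq.ext_proj fun i => ?_
  obtain ⟨n, hn⟩ := c.cofinal i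
  obtain ⟨n', hn', h'⟩ := (h.and (eventually_ge_atTop n)).exists
  have hi := hn.trans (c.k_dvd_of_le h')
  rw [OdometerSeq.proj_vadd, c.proj_toFun hi, c.proj_toFun hi]
  have := congrArg (Int.cast : ℤ → ZMod (a.k i)) hn'
  simpa using this

/-- The factor map is injective on a set of points for which the position modulo `k (n + 1)`
determines the position in the block of length `m_n`, for infinitely many `n`. -/
theorem injOn_toFun {s : Set m.Odometer}
    (hk : ∀ n, ∃ i, c.k n ∣ a.k i)
    (h : ∀ z ∈ s, ∀ z' ∈ s, ∃ᶠ n in atTop, c.pos (n + 1) z % c.k (n + 1) % m.k n = c.pos n z ∧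
      c.pos (n + 1) z' % c.k (n + 1) % m.k n = c.pos n z') :
    Set.InjOn c.toFun s := by
  intro z hz z' hz' heq
  refine OdometerSeq.ext_res_frequently ((h z hz z' hz').mono fun n hn => ?_)
  refine (c.bijOn n).injOn (m.res_lt n z) (m.res_lt n z') ?_
  change c.pos n z = c.pos n z'
  obtain ⟨i, hi⟩ := hk (n + 1)
  obtain ⟨l, hl⟩ := c.cofinal i
  have h1 := congrArg (a.proj i) heq
  have hl' := hl.trans (c.k_dvd_of_le (le_max_left l (n + 1)))
  rw [c.proj_toFun hl', c.proj_toFun hl', ZMod.natCast_eq_natCast_iff] at h1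
  have h2 := (c.pos_modEq (le_max_right l (n + 1)) z).symm.trans
    ((h1.of_dvd hi).trans (c.pos_modEq (le_max_right l (n + 1)) z'))
  rw [← hn.1, ← hn.2, h2]

end Coding

/-! ### Successors along one coding and their displacement along another -/

/-- Copy number `B` of a block of length `m` inside a longer block, and also the next copy, are
intervals of the longer block for the position functions `σ` (short block) and `σ'` (long block);
moreover these two intervals are adjacent.  The points of copy number `B` are the labels
`m * B + r` with `r < m`. -/
def TranslatesAt (m : ℕ) (σ σ' : ℕ → ℕ) (B : ℕ) : Prop :=
  ∃ α, ∀ r < m, σ' (m * B + r) = α + σ r ∧ σ' (m * (B + 1) + r) = α + m + σ r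

variable {m a b : OdometerSeq}

/-- The points whose block of length `m_n` is one of the exceptional copies `bad n` inside its block
of length `m_(n+1)`. -/
def badSet (m : OdometerSeq) (bad : ℕ → Finset ℕ) (n : ℕ) : Set m.Odometer :=
  {z | m.res (n + 1) z / m.k n ∈ bad n}

/-- The points which are last in their block of length `m_n`. -/
def Coding.lastSet (c : Coding m a) (n : ℕ) : Set m.Odometer := {z | c.pos n z + 1 = m.k n}

theorem measurableSet_badSet (bad : ℕ → Finset ℕ) (n : ℕ) : MeasurableSet (badSet m bad n) :=
  m.measurable_res (n + 1) (MeasurableSet.of_discrete (s := {r | r / m.k n ∈ bad n}))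

theorem Coding.measurableSet_lastSet (c : Coding m a) (n : ℕ) : MeasurableSet (c.lastSet n) :=
  c.measurable_pos n (MeasurableSet.of_discrete (s := {r | r + 1 = m.k n}))

theorem measure_badSet_le (bad : ℕ → Finset ℕ) (n : ℕ) :
    m.measure (badSet m bad n) ≤ ((bad n).card * m.k n : ℕ) / m.k (n + 1) := by
  let s := (bad n ×ˢ Finset.range (m.k n)).image fun x => m.k n * x.1 + x.2
  have hs : s.card ≤ (bad n).card * m.k n :=
    Finset.card_image_le.trans (by simp)
  refine (measure_mono fun z hz => ?_).trans ((m.measure_res_mem_le (n + 1) s).trans ?_)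
  · refine Finset.mem_image.2 ⟨(m.res (n + 1) z / m.k n, m.res (n + 1) z % m.k n), ?_,
      Nat.div_add_mod _ _⟩
    exact Finset.mem_product.2 ⟨hz, Finset.mem_range.2 (Nat.mod_lt _ (m.pos n))⟩
  · gcongr

theorem Coding.measure_lastSet_le (c : Coding m a) (n : ℕ) :
    m.measure (c.lastSet n) ≤ 1 / m.k n := by
  obtain ⟨p, hp, hp'⟩ := (c.bijOn n).surjOn (show m.k n - 1 ∈ Set.Iio (m.k n) by
    have := m.pos n
    simp only [Set.mem_Iio]
    omega)
  refine (measure_mono fun z hz => ?_).trans ((m.measure_res_mem_le n {p}).trans ?_)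
  · refine Finset.mem_singleton.2 ((c.bijOn n).injOn (m.res_lt n z) hp ?_)
    change c.pos n z = _
    change c.pos n z + 1 = _ at hz
    omega
  · simp

/-- Moving a point inside its block of length `m_N` changes all later residues by the same
amount. -/
theorem exists_res_eq (z : m.Odometer) {N p : ℕ} (hp : p < m.k N) :
    ∃ z' : m.Odometer, m.res N z' = p ∧
      ∀ n, N ≤ n → m.res (n + 1) z' / m.k n = m.res (n + 1) z / m.k n := by
  have key : ∀ n, N ≤ n → ∃ r < m.k n, (m.res n z : ℤ) + (p - m.res N z) = r ∧
      m.res (n + 1) z % m.k n = m.res n z := by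
    intro n hn
    refine ⟨m.k N * (m.res n z / m.k N) + p, ?_, ?_, m.res_succ_mod n z⟩
    · obtain ⟨q, hq⟩ := m.dvd_of_le hn
      have h1 : m.res n z / m.k N < q := by
        rw [Nat.div_lt_iff_lt_mul (m.pos N), mul_comm, ← hq]
        exact m.res_lt n z
      calc m.k N * (m.res n z / m.k N) + p < m.k N * (m.res n z / m.k N + 1) := by
            rw [mul_add, mul_one]; omega
        _ ≤ m.k N * q := Nat.mul_le_mul_left _ h1
        _ = m.k n := hq.symm
    · have h1 := Nat.div_add_mod (m.res n z) (m.k N)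
      rw [m.res_of_le hn] at h1
      push_cast
      rw [← h1]
      push_cast
      have h2 : (m.k N : ℤ) * (((m.k N * (m.res n z / m.k N) + m.res N z : ℕ) : ℤ) / m.k N) =
          m.k N * (m.res n z / m.k N) := by
        rw [h1]
      push_cast at h2
      linarith
  refine ⟨((p : ℤ) - m.res N z) +ᵥ z, ?_, fun n hn => ?_⟩
  · exact OdometerSeq.res_vadd (by ring) hp
  · obtain ⟨r, hr, hr', hmod⟩ := key n hn
    obtain ⟨r', hr1, hr1', -⟩ := key (n + 1) (hn.trans n.le_succ)
    rw [OdometerSeq.res_vadd hr1' hr1]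
    have h1 := Nat.div_add_mod (m.res (n + 1) z) (m.k n)
    rw [hmod] at h1
    have h2 : r' = r + m.k n * (m.res (n + 1) z / m.k n) := by
      have h1' : (m.k n : ℤ) * (m.res (n + 1) z / m.k n : ℕ) + m.res n z = m.res (n + 1) z := by
        exact_mod_cast h1
      zify
      zify at h1'
      linarith
    rw [h2, Nat.add_mul_div_left _ _ (m.pos n), Nat.div_eq_of_lt hr, zero_add]

theorem Coding.pos_succ (c : Coding m a) {n : ℕ} {z : m.Odometer} {α : ℕ}
    (h : ∀ r < m.k n, c.σ (n + 1) (m.k n * (m.res (n + 1) z / m.k n) + r) = α + c.σ n r) :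
    c.pos (n + 1) z = α + c.pos n z := by
  have := h _ (m.res_lt n z)
  rw [← m.res_succ_mod n z, Nat.div_add_mod, m.res_succ_mod] at this
  exact this

/-- If two points agree above level `N` and no later copy is exceptional, their relative position
does not change any more. -/
theorem Coding.pos_sub_pos (c : Coding m a) {bad : ℕ → Finset ℕ}
    (hc : ∀ n B, B ∉ bad n → m.k n * B < m.k (n + 1) → TranslatesAt (m.k n) (c.σ n) (c.σ (n + 1)) B)
    {z z' : m.Odometer} {N : ℕ} (hz : ∀ n, N ≤ n → z ∉ badSet m bad n)
    (hzz' : ∀ n, N ≤ n → m.res (n + 1) z' / m.k n = m.res (n + 1) z / m.k n) {n : ℕ}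
    (hn : N ≤ n) : (c.pos n z' : ℤ) = (c.pos N z' - c.pos N z : ℤ) + c.pos n z := by
  induction n, hn using Nat.le_induction with
  | base => ring
  | succ n hn ih =>
    have hlt : m.k n * (m.res (n + 1) z / m.k n) < m.k (n + 1) :=
      (Nat.mul_div_le _ _).trans_lt (m.res_lt (n + 1) z)
    obtain ⟨α, hα⟩ := hc n _ (hz n hn) hlt
    rw [c.pos_succ (z := z) fun r hr => (hα r hr).1,
      c.pos_succ (z := z') fun r hr => by rw [hzz' n hn]; exact (hα r hr).1]
    push_cast
    linarith

/-- The contribution of level `n` to `Coding.cost`: it accounts for the exceptional blocks and for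
the last points of the blocks at this level. -/
noncomputable def Coding.costAt (c : Coding m a) (bad : ℕ → Finset ℕ) (ω : ℕ → ℝ≥0) (n : ℕ)
    (z : m.Odometer) : ℝ≥0∞ :=
  (badSet m bad n).indicator (fun _ => (ω (m.k (n + 1)) : ℝ≥0∞)) z +
    (c.lastSet n).indicator (fun _ => (ω (2 * m.k n) : ℝ≥0∞)) z

/-- An upper bound for `ω` of the displacement of a point in the second odometer when it moves to
its successor in the first one. -/
noncomputable def Coding.cost (c : Coding m a) (bad : ℕ → Finset ℕ) (ω : ℕ → ℝ≥0)
    (z : m.Odometer) : ℝ≥0∞ :=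
  ω 1 + ∑' n, c.costAt bad ω n z

theorem Coding.measurable_costAt (c : Coding m a) (bad : ℕ → Finset ℕ) (ω : ℕ → ℝ≥0) (n : ℕ) :
    Measurable (c.costAt bad ω n) :=
  (measurable_const.indicator (measurableSet_badSet bad n)).add
    (measurable_const.indicator (c.measurableSet_lastSet n))

theorem Coding.measurable_cost (c : Coding m a) (bad : ℕ → Finset ℕ) (ω : ℕ → ℝ≥0) :
    Measurable (c.cost bad ω) :=
  measurable_const.add (Measurable.tsum fun n => c.measurable_costAt bad ω n)

/-- The successor of a point `z` in the first odometer.  From some least level `N` on, `z` is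
neither exceptional nor last in its block, so its successor lies in the same block of length `m_N`.  If
`N = 0` the displacement in the second odometer is `1`.  Otherwise `z` was exceptional at level
`N - 1`, and the displacement is below `m_N`, or it was last there, and the successor lies in the
adjacent copy, at distance at most `2 * m_(N-1)`. -/
theorem Coding.exists_succ (c : Coding m a) (d : Coding m b) {bad : ℕ → Finset ℕ}
    {ω : ℕ → ℝ≥0} (hω : Monotone ω)
    (h₀ : ∀ p < m.k 0, c.σ 0 p = p ∧ d.σ 0 p = p)
    (hbad : ∀ n B, B ∉ bad n → m.k n * B < m.k (n + 1) → m.k n * (B + 2) ≤ m.k (n + 1))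
    (hc : ∀ n B, B ∉ bad n → m.k n * B < m.k (n + 1) → TranslatesAt (m.k n) (c.σ n) (c.σ (n + 1)) B)
    (hd : ∀ n B, B ∉ bad n → m.k n * B < m.k (n + 1) → TranslatesAt (m.k n) (d.σ n) (d.σ (n + 1)) B)
    {z : m.Odometer} (hz : ∀ᶠ n in atTop, z ∉ badSet m bad n)
    (hz' : ∀ᶠ n in atTop, z ∉ c.lastSet n) :
    ∃ (z' : m.Odometer) (j : ℤ), (∀ᶠ n in atTop, z' ∉ badSet m bad n) ∧
      c.toFun z' = (1 : ℤ) +ᵥ c.toFun z ∧ d.toFun z' = j +ᵥ d.toFun z ∧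
      (ω j.natAbs : ℝ≥0∞) ≤ c.cost bad ω z := by
  classical
  obtain ⟨N₀, hN₀⟩ := eventually_atTop.1 (hz.and hz')
  have hex : ∃ N, ∀ n, N ≤ n → z ∉ badSet m bad n ∧ z ∉ c.lastSet n := ⟨N₀, hN₀⟩
  -- The least level from which on `z` is neither exceptional nor last.
  obtain ⟨N, hN, hmin⟩ : ∃ N, (∀ n, N ≤ n → z ∉ badSet m bad n ∧ z ∉ c.lastSet n) ∧
      ∀ n < N, ¬ ∀ i, n ≤ i → z ∉ badSet m bad i ∧ z ∉ c.lastSet i :=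
    ⟨Nat.find hex, Nat.find_spec hex, fun n hn => Nat.find_min hex hn⟩
  have hlt : c.pos N z + 1 < m.k N := lt_of_le_of_ne (c.pos_lt N z) (hN N le_rfl).2
  obtain ⟨p, hp, hpz⟩ := (c.bijOn N).surjOn hlt
  obtain ⟨z', hz'p, hzz'⟩ := exists_res_eq z hp
  have hpos : c.pos N z' = c.pos N z + 1 := by rw [← hpz, Coding.pos, hz'p]
  have hzN : ∀ n, N ≤ n → z ∉ badSet m bad n := fun n hn => (hN n hn).1
  refine ⟨z', d.pos N z' - d.pos N z, ?_, ?_, ?_, ?_⟩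
  · refine eventually_atTop.2 ⟨N, fun n hn hb => hzN n hn ?_⟩
    change m.res (n + 1) z / m.k n ∈ bad n
    rw [← hzz' n hn]
    exact hb
  · refine c.toFun_eq_vadd (eventually_atTop.2 ⟨N, fun n hn => ?_⟩)
    rw [c.pos_sub_pos hc hzN hzz' hn, hpos]
    push_cast
    ring
  · exact d.toFun_eq_vadd (eventually_atTop.2 ⟨N, fun n hn => d.pos_sub_pos hd hzN hzz' hn⟩)
  have hdz := d.pos_lt N z
  have hdz' := d.pos_lt N z'
  rcases N with _ | N
  · have h1 := (h₀ _ (m.res_lt 0 z)).1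
    have h2 := (h₀ _ (m.res_lt 0 z)).2
    have h3 := (h₀ _ (m.res_lt 0 z')).1
    have h4 := (h₀ _ (m.res_lt 0 z')).2
    simp only [Coding.pos] at hpos ⊢
    rw [h1, h3] at hpos
    rw [h2, h4, hpos]
    simp [Coding.cost]
  · refine le_trans ?_ ((ENNReal.le_tsum N).trans le_add_self)
    rw [Coding.costAt]
    by_cases hb : z ∈ badSet m bad N
    · rw [Set.indicator_of_mem hb]
      refine le_trans (ENNReal.coe_le_coe.2 (hω ?_)) le_self_add
      omega
    -- The successor lies in the next copy of the block of length `m_N`.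
    have hl : z ∈ c.lastSet N := by
      by_contra hl
      refine hmin N (Nat.lt_succ_self N) fun i hi => ?_
      rcases hi.eq_or_lt with rfl | hi
      exacts [⟨hb, hl⟩, hN i hi]
    rw [Set.indicator_of_mem hl]
    refine le_trans (ENNReal.coe_le_coe.2 (hω ?_)) le_add_self
    change c.pos N z + 1 = m.k N at hl
    have hB : m.k N * (m.res (N + 1) z / m.k N) < m.k (N + 1) :=
      (Nat.mul_div_le _ _).trans_lt (m.res_lt (N + 1) z)
    obtain ⟨α, hα⟩ := hc N _ hb hB
    obtain ⟨β, hβ⟩ := hd N _ hb hB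
    have hB' := hbad N _ hb hB
    obtain ⟨r, hr, hr0⟩ := (c.bijOn N).surjOn (show 0 ∈ Set.Iio (m.k N) from m.pos N)
    have hpr : p = m.k N * (m.res (N + 1) z / m.k N + 1) + r := by
      refine (c.bijOn (N + 1)).injOn hp ?_ ?_
      · simp only [Set.mem_Iio] at hr ⊢
        calc _ < m.k N * (m.res (N + 1) z / m.k N + 1) + m.k N := by omega
          _ = m.k N * (m.res (N + 1) z / m.k N + 2) := by ring
          _ ≤ _ := hB'
      · rw [hpz, c.pos_succ fun r hr => (hα r hr).1, (hα r hr).2, hr0]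
        omega
    have h1 : d.pos (N + 1) z' = β + m.k N + d.σ N r := by
      rw [Coding.pos, hz'p, hpr, (hβ r hr).2]
    have h2 := d.pos_succ fun r hr => (hβ r hr).1
    have h3 := d.pos_lt N z
    have h4 : d.σ N r < m.k N := (d.bijOn N).mapsTo hr
    rw [h1, h2]
    omega

theorem Coding.lintegral_cost_lt (c : Coding m a) {bad : ℕ → Finset ℕ} {ω : ℕ → ℝ≥0}
    {ε : ℕ → ℝ≥0∞} {δ : ℝ≥0∞} (hδ : ∑' n, 2 * ε n < δ)
    (hεbad : ∀ n, ω (m.k (n + 1)) * m.measure (badSet m bad n) ≤ ε n)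
    (hεlast : ∀ n, ω (2 * m.k n) * m.measure (c.lastSet n) ≤ ε n) :
    ∫⁻ z, c.cost bad ω z ∂m.measure < ω 1 + δ := by
  unfold Coding.cost
  rw [lintegral_add_left measurable_const, lintegral_const, measure_univ, mul_one]
  refine ENNReal.add_lt_add_left ENNReal.coe_ne_top (lt_of_le_of_lt ?_ hδ)
  rw [lintegral_tsum fun n => (c.measurable_costAt bad ω n).aemeasurable]
  refine ENNReal.tsum_le_tsum fun n => ?_
  unfold Coding.costAt
  rw [lintegral_add_left (measurable_const.indicator (measurableSet_badSet bad n)),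
    lintegral_indicator_const (measurableSet_badSet bad n),
    lintegral_indicator_const (c.measurableSet_lastSet n), two_mul (ε n)]
  exact add_le_add (hεbad n) (hεlast n)

/-! ### The orbit equivalence defined by a pair of codings -/

theorem measurableSet_eventually_notMem {X : Type*} [MeasurableSpace X] {s : ℕ → Set X}
    (hs : ∀ n, MeasurableSet (s n)) : MeasurableSet {x | ∀ᶠ n in atTop, x ∉ s n} := by
  convert MeasurableSet.measurableSet_liminf fun n => (hs n).compl using 1
  ext x
  simp [Filter.mem_liminf_iff_eventually_mem]

theorem ae_eventually_notMem_of_le {X : Type*} [MeasurableSpace X] {μ : Measure X}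
    {s : ℕ → Set X} {ε w : ℕ → ℝ≥0∞} (hε : ∑' n, ε n ≠ ∞) (h : ∀ n, (w n + 1) * μ (s n) ≤ ε n) :
    ∀ᵐ x ∂μ, ∀ᶠ n in atTop, x ∉ s n := by
  refine ae_eventually_notMem (ne_top_of_le_ne_top hε (ENNReal.tsum_le_tsum fun n => ?_))
  exact le_trans (by rw [add_mul, one_mul]; exact le_add_self) (h n)

variable {m a b : OdometerSeq}

/-- Two codings `c` and `d` of the odometer of `m` in which all non-exceptional copies of blocks are
intervals yield an orbit equivalence `d ∘ c⁻¹`, with cocycles controlled by `Coding.cost`. -/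
theorem exists_measureIso_of_codings (c : Coding m a) (d : Coding m b) {bad : ℕ → Finset ℕ}
    {ω : ℕ → ℝ≥0} (hω : Monotone ω) {ε : ℕ → ℝ≥0∞} {δ : ℝ≥0} (hε : ∑' n, 2 * ε n < δ)
    (h₀ : ∀ p < m.k 0, c.σ 0 p = p ∧ d.σ 0 p = p)
    (hbad : ∀ n B, B ∉ bad n → m.k n * B < m.k (n + 1) → m.k n * (B + 2) ≤ m.k (n + 1))
    (hc : ∀ n B, B ∉ bad n → m.k n * B < m.k (n + 1) → TranslatesAt (m.k n) (c.σ n) (c.σ (n + 1)) B)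
    (hd : ∀ n B, B ∉ bad n → m.k n * B < m.k (n + 1) → TranslatesAt (m.k n) (d.σ n) (d.σ (n + 1)) B)
    (hck : ∀ n, ∃ i, c.k n ∣ a.k i) (hdk : ∀ n, ∃ i, d.k n ∣ b.k i)
    (hcr : ∃ᶠ n in atTop, ∀ p < m.k (n + 1), p / m.k n ∉ bad n →
      c.σ (n + 1) p % c.k (n + 1) % m.k n = c.σ n (p % m.k n))
    (hdr : ∃ᶠ n in atTop, ∀ p < m.k (n + 1), p / m.k n ∉ bad n →
      d.σ (n + 1) p % d.k (n + 1) % m.k n = d.σ n (p % m.k n))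
    (hεbad : ∀ n, (ω (m.k (n + 1)) + 1) * m.measure (badSet m bad n) ≤ ε n)
    (hεc : ∀ n, (ω (2 * m.k n) + 1) * m.measure (c.lastSet n) ≤ ε n)
    (hεd : ∀ n, (ω (2 * m.k n) + 1) * m.measure (d.lastSet n) ≤ ε n) :
    ∃ φ : MeasureIso a.measure b.measure, φ.IsOmegaOrbitEquivalence ω ω ∧
      omegaNorm a.measure ω (cocycle φ.toFun 1) < (ω 1 : ℝ≥0∞) + (δ : ℝ≥0∞) ∧
      omegaNorm b.measure ω (cocycle φ.invFun 1) < (ω 1 : ℝ≥0∞) + (δ : ℝ≥0∞) := by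
  have hε' : ∑' n, ε n ≠ ∞ := by
    refine ne_top_of_le_ne_top (hε.trans ENNReal.coe_lt_top).ne (ENNReal.tsum_le_tsum fun n => ?_)
    rw [two_mul]
    exact le_add_self
  have hle : ∀ x y z : ℝ≥0∞, (x + 1) * y ≤ z → x * y ≤ z := fun x y z h =>
    le_trans (mul_le_mul_left le_self_add y) h
  let s : Set m.Odometer := {z | ∀ᶠ n in atTop, z ∉ badSet m bad n}
  have hs : MeasurableSet s := measurableSet_eventually_notMem (measurableSet_badSet bad)
  have hs' : ∀ᵐ z ∂m.measure, z ∈ s := ae_eventually_notMem_of_le hε' hεbad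
  have hinj : ∀ {a' : OdometerSeq} (e : Coding m a'), (∀ n, ∃ i, e.k n ∣ a'.k i) →
      (∃ᶠ n in atTop, ∀ p < m.k (n + 1), p / m.k n ∉ bad n →
        e.σ (n + 1) p % e.k (n + 1) % m.k n = e.σ n (p % m.k n)) → Set.InjOn e.toFun s := by
    intro a' e hek her
    refine e.injOn_toFun hek fun z hz z' hz' => (her.and_eventually (hz.and hz')).mono ?_
    rintro n ⟨h1, h2, h3⟩
    have h4 := h1 _ (m.res_lt (n + 1) z) h2
    have h5 := h1 _ (m.res_lt (n + 1) z') h3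
    rw [m.res_succ_mod] at h4 h5
    exact ⟨h4, h5⟩
  obtain ⟨f, hf, hfc, hcf⟩ := exists_measurePreserving_leftInverse c.measurePreserving_toFun hs hs'
    (hinj c hck hcr) ⟨0⟩
  obtain ⟨g, hg, hgd, hdg⟩ := exists_measurePreserving_leftInverse d.measurePreserving_toFun hs hs'
    (hinj d hdk hdr) ⟨0⟩
  let φ : MeasureIso a.measure b.measure :=
    { toFun := d.toFun ∘ f
      invFun := c.toFun ∘ g
      measurePreserving_toFun := d.measurePreserving_toFun.comp hf
      measurePreserving_invFun := c.measurePreserving_toFun.comp hg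
      left_inv := by
        filter_upwards [hcf s le_rfl hs' hs]
        rintro _ ⟨z, hz, rfl⟩
        simp only [Function.comp, hfc z hz, hgd z hz]
      right_inv := by
        filter_upwards [hdg s le_rfl hs' hs]
        rintro _ ⟨z, hz, rfl⟩
        simp only [Function.comp, hgd z hz, hfc z hz] }
  have hφ : ∀ᵐ x ∂a.measure, ∃ j : ℤ, φ.toFun ((1 : ℤ) +ᵥ x) = j +ᵥ φ.toFun x ∧
      (ω j.natAbs : ℝ≥0∞) ≤ c.cost bad ω (f x) := by
    filter_upwards [hcf (s ∩ {z | ∀ᶠ n in atTop, z ∉ c.lastSet n}) Set.inter_subset_left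
      (hs'.and (ae_eventually_notMem_of_le hε' hεc))
      (hs.inter (measurableSet_eventually_notMem c.measurableSet_lastSet))]
    rintro _ ⟨z, ⟨hz, hzl⟩, rfl⟩
    obtain ⟨z', j, hz', h1, h2, h3⟩ := c.exists_succ d hω h₀ hbad hc hd hz hzl
    refine ⟨j, ?_, by rwa [hfc z hz]⟩
    simp only [φ, Function.comp]
    rw [← h1, hfc z' hz', hfc z hz, h2]
  have hψ : ∀ᵐ y ∂b.measure, ∃ j : ℤ, φ.invFun ((1 : ℤ) +ᵥ y) = j +ᵥ φ.invFun y ∧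
      (ω j.natAbs : ℝ≥0∞) ≤ d.cost bad ω (g y) := by
    filter_upwards [hdg (s ∩ {z | ∀ᶠ n in atTop, z ∉ d.lastSet n}) Set.inter_subset_left
      (hs'.and (ae_eventually_notMem_of_le hε' hεd))
      (hs.inter (measurableSet_eventually_notMem d.measurableSet_lastSet))]
    rintro _ ⟨z, ⟨hz, hzl⟩, rfl⟩
    obtain ⟨z', j, hz', h1, h2, h3⟩ :=
      d.exists_succ c hω (fun p hp => (h₀ p hp).symm) hbad hd hc hz hzl
    refine ⟨j, ?_, by rwa [hgd z hz]⟩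
    simp only [φ, Function.comp]
    rw [← h1, hgd z' hz', hgd z hz, h2]
  have hfm : Measurable fun x => c.cost bad ω (f x) := (c.measurable_cost bad ω).comp hf.measurable
  have hgm : Measurable fun y => d.cost bad ω (g y) := (d.measurable_cost bad ω).comp hg.measurable
  have hfi : ∫⁻ x, c.cost bad ω (f x) ∂a.measure < ω 1 + δ := by
    rw [hf.lintegral_comp (c.measurable_cost bad ω)]
    exact c.lintegral_cost_lt hε (fun n => hle _ _ _ (hεbad n)) fun n => hle _ _ _ (hεc n)
  have hgi : ∫⁻ y, d.cost bad ω (g y) ∂b.measure < ω 1 + δ := by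
    rw [hg.lintegral_comp (d.measurable_cost bad ω)]
    exact d.lintegral_cost_lt hε (fun n => hle _ _ _ (hεbad n)) fun n => hle _ _ _ (hεd n)
  have htop : (ω 1 + δ : ℝ≥0∞) < ∞ := ENNReal.add_lt_top.2 ⟨ENNReal.coe_lt_top, ENNReal.coe_lt_top⟩
  refine ⟨φ, ⟨φ.isOrbitEquivalence_of_one a.measurePreserving_vadd b.measurePreserving_vadd
    (hφ.mono fun x ⟨j, hj, _⟩ => ⟨j, hj⟩) (hψ.mono fun y ⟨j, hj, _⟩ => ⟨j, hj⟩), fun g' => ?_,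
    fun g' => ?_⟩, (omegaNorm_cocycle_le b.eq_zero_of_vadd_eq hφ).trans_lt hfi,
    (omegaNorm_cocycle_le a.eq_zero_of_vadd_eq hψ).trans_lt hgi⟩
  · exact lintegral_cocycle_lt_top hω a.measurePreserving_vadd b.eq_zero_of_vadd_eq hfm
      (hfi.trans htop) hφ g'
  · exact lintegral_cocycle_lt_top hω b.measurePreserving_vadd a.eq_zero_of_vadd_eq hgm
      (hgi.trans htop) hψ g'

/-! ### Blocks carrying two orders -/

theorem bijOn_Iio_of_injOn {m : ℕ} {f : ℕ → ℕ} (h : Set.MapsTo f (Set.Iio m) (Set.Iio m))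
    (hf : Set.InjOn f (Set.Iio m)) : Set.BijOn f (Set.Iio m) (Set.Iio m) := by
  refine ⟨h, hf, ?_⟩
  have := Finset.surjOn_of_injOn_of_card_le (s := Finset.range m) (t := Finset.range m) f
    (by simpa using h) (by simpa using hf) le_rfl
  simpa using this

theorem mul_add_inj {m x x' r r' : ℕ} (hr : r < m) (hr' : r' < m)
    (h : x * m + r = x' * m + r') : x = x' ∧ r = r' := by
  have h1 : (x * m + r) / m = x := by
    rw [mul_comm, Nat.mul_add_div (by omega), Nat.div_eq_of_lt hr, add_zero]
  have h2 : (x' * m + r') / m = x' := by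
    rw [mul_comm, Nat.mul_add_div (by omega), Nat.div_eq_of_lt hr', add_zero]
  have h3 : x = x' := by rw [← h1, ← h2, h]
  subst h3
  exact ⟨rfl, by omega⟩

theorem mul_add_lt {m l x r : ℕ} (hx : x < l) (hr : r < m) : x * m + r < l * m :=
  calc x * m + r < (x + 1) * m := by rw [add_mul, one_mul]; omega
    _ ≤ l * m := Nat.mul_le_mul_right m hx

/-- A block of `m = k * l` labels `p < m` with two linear orders, given by the positions `σ p` and
`τ p`.  In the first order it is to be thought of as a union of `l` intervals of length `k`, in
the second order as a union of `k` intervals of length `l`. -/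
structure Block where
  (k l m : ℕ)
  (σ τ : ℕ → ℕ)
  k_pos : 0 < k
  l_pos : 0 < l
  m_eq : m = k * l
  σ_bijOn : Set.BijOn σ (Set.Iio m) (Set.Iio m)
  τ_bijOn : Set.BijOn τ (Set.Iio m) (Set.Iio m)

/-- `Q` is composed of copies of `P`: the label `P.m * B + r` of `Q` belongs to copy number `B`.
The positions modulo `P.k` and `P.l` are unchanged, and unless `B ∈ bad`, the copies `B` and `B + 1`
are adjacent intervals in both orders. -/
structure Block.Extends (P Q : Block) (bad : Finset ℕ) : Prop where
  k_dvd : P.k ∣ Q.k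
  l_dvd : P.l ∣ Q.l
  m_lt : P.m < Q.m
  m_dvd : P.m ∣ Q.m
  σ_modEq : ∀ p < Q.m, Q.σ p ≡ P.σ (p % P.m) [MOD P.k]
  τ_modEq : ∀ p < Q.m, Q.τ p ≡ P.τ (p % P.m) [MOD P.l]
  le_of_notMem : ∀ B, B ∉ bad → P.m * B < Q.m → P.m * (B + 2) ≤ Q.m
  σ_translatesAt : ∀ B, B ∉ bad → P.m * B < Q.m → TranslatesAt P.m P.σ Q.σ B
  τ_translatesAt : ∀ B, B ∉ bad → P.m * B < Q.m → TranslatesAt P.m P.τ Q.τ B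

namespace Block

variable (P : Block)

theorem m_pos : 0 < P.m := by
  rw [P.m_eq]
  exact Nat.mul_pos P.k_pos P.l_pos

/-- The block with the two orders interchanged. -/
def swap : Block where
  k := P.l
  l := P.k
  m := P.m
  σ := P.τ
  τ := P.σ
  k_pos := P.l_pos
  l_pos := P.k_pos
  m_eq := by rw [P.m_eq, mul_comm]
  σ_bijOn := P.τ_bijOn
  τ_bijOn := P.σ_bijOn

theorem Extends.swap {P Q : Block} {bad : Finset ℕ} (h : P.Extends Q bad) :
    P.swap.Extends Q.swap bad where
  k_dvd := h.l_dvd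
  l_dvd := h.k_dvd
  m_lt := h.m_lt
  m_dvd := h.m_dvd
  σ_modEq := h.τ_modEq
  τ_modEq := h.σ_modEq
  le_of_notMem := h.le_of_notMem
  σ_translatesAt := h.τ_translatesAt
  τ_translatesAt := h.σ_translatesAt

/-- The first position in the extension of `P` to `l` intervals of length `k' = q * m + k * s`.
Each of these begins with `q` intact copies of `P`.  The intervals of length `k` in the remaining
`s` copies of `P` are distributed over the ends of the `l` intervals of length `k'`. -/
def extσ (q s p : ℕ) : ℕ :=
  if p / P.m < P.l * q then
    p / P.m / q * (q * P.m + P.k * s) + (p / P.m % q * P.m + P.σ (p % P.m))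
  else P.σ (p % P.m) / P.k * (q * P.m + P.k * s) +
    (q * P.m + ((p / P.m - P.l * q) * P.k + P.σ (p % P.m) % P.k))

/-- The second position in the extension of `P`: the copies of `P` are concatenated. -/
def extτ (p : ℕ) : ℕ := p / P.m * P.m + P.τ (p % P.m)

variable {P} {q s : ℕ}

theorem σ_mod_lt (p : ℕ) : P.σ (p % P.m) < P.m := P.σ_bijOn.mapsTo (Nat.mod_lt p P.m_pos)

theorem τ_mod_lt (p : ℕ) : P.τ (p % P.m) < P.m := P.τ_bijOn.mapsTo (Nat.mod_lt p P.m_pos)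

/-- Quotient and remainder by `k'` of the first position of a point in an intact copy. -/
theorem extσ_of_lt {p : ℕ} (h : p / P.m < P.l * q) :
    P.extσ q s p / (q * P.m + P.k * s) = p / P.m / q ∧
    P.extσ q s p % (q * P.m + P.k * s) = p / P.m % q * P.m + P.σ (p % P.m) ∧
    p / P.m / q < P.l ∧ p / P.m % q * P.m + P.σ (p % P.m) < q * P.m := by
  have hq : 0 < q := Nat.pos_of_ne_zero fun h0 => by simp [h0] at h
  have h1 : p / P.m % q * P.m + P.σ (p % P.m) < q * P.m :=
    mul_add_lt (Nat.mod_lt _ hq) (σ_mod_lt p)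
  have h2 : p / P.m % q * P.m + P.σ (p % P.m) < q * P.m + P.k * s := by omega
  refine ⟨?_, ?_, (Nat.div_lt_iff_lt_mul hq).2 h, h1⟩
  · rw [extσ, if_pos h, mul_comm, Nat.mul_add_div (by omega), Nat.div_eq_of_lt h2, add_zero]
  · rw [extσ, if_pos h, mul_comm, Nat.mul_add_mod, Nat.mod_eq_of_lt h2]

/-- Quotient and remainder by `k'` of the first position of a point in a distributed copy. -/
theorem extσ_of_ge {p : ℕ} (h : P.l * q ≤ p / P.m) (hp : p / P.m < P.l * q + s) :
    P.extσ q s p / (q * P.m + P.k * s) = P.σ (p % P.m) / P.k ∧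
    P.extσ q s p % (q * P.m + P.k * s) =
      q * P.m + ((p / P.m - P.l * q) * P.k + P.σ (p % P.m) % P.k) ∧
    P.σ (p % P.m) / P.k < P.l ∧
    (p / P.m - P.l * q) * P.k + P.σ (p % P.m) % P.k < P.k * s := by
  have h1 : (p / P.m - P.l * q) * P.k + P.σ (p % P.m) % P.k < P.k * s := by
    rw [mul_comm P.k s]
    exact mul_add_lt (by omega) (Nat.mod_lt _ P.k_pos)
  have h2 : q * P.m + ((p / P.m - P.l * q) * P.k + P.σ (p % P.m) % P.k) <
      q * P.m + P.k * s := by omega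
  refine ⟨?_, ?_, ?_, h1⟩
  · rw [extσ, if_neg (by omega), mul_comm, Nat.mul_add_div (by omega), Nat.div_eq_of_lt h2,
      add_zero]
  · rw [extσ, if_neg (by omega), mul_comm, Nat.mul_add_mod, Nat.mod_eq_of_lt h2]
  · rw [Nat.div_lt_iff_lt_mul P.k_pos, mul_comm, ← P.m_eq]
    exact σ_mod_lt p

theorem ext_m_eq : P.m * (P.l * q + s) = (q * P.m + P.k * s) * P.l := by
  rw [P.m_eq]
  ring

theorem extσ_bijOn : Set.BijOn (P.extσ q s) (Set.Iio (P.m * (P.l * q + s)))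
    (Set.Iio (P.m * (P.l * q + s))) := by
  have hB : ∀ {p}, p < P.m * (P.l * q + s) → p / P.m < P.l * q + s := fun hp =>
    Nat.div_lt_of_lt_mul hp
  refine bijOn_Iio_of_injOn (fun p hp => ?_) fun p hp p' hp' h => ?_
  · rw [Set.mem_Iio, ext_m_eq, mul_comm, ← Nat.div_add_mod (P.extσ q s p) (q * P.m + P.k * s),
      mul_comm (q * P.m + P.k * s)]
    rcases lt_or_ge (p / P.m) (P.l * q) with h | h
    · obtain ⟨h1, h2, h3, h4⟩ := extσ_of_lt (s := s) h
      exact mul_add_lt (h1 ▸ h3) (by omega)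
    · obtain ⟨h1, h2, h3, h4⟩ := extσ_of_ge h (hB hp)
      exact mul_add_lt (h1 ▸ h3) (by omega)
  · -- Points in intact and in distributed copies are distinguished by the remainder.
    have key : p / P.m = p' / P.m ∧ P.σ (p % P.m) = P.σ (p' % P.m) := by
      rcases lt_or_ge (p / P.m) (P.l * q) with h0 | h0 <;>
        rcases lt_or_ge (p' / P.m) (P.l * q) with h0' | h0'
      · obtain ⟨h1, h2, h3, h4⟩ := extσ_of_lt (s := s) h0
        obtain ⟨h1', h2', h3', h4'⟩ := extσ_of_lt (s := s) h0'
        rw [h] at h1 h2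
        obtain ⟨h5, h6⟩ := mul_add_inj (σ_mod_lt p) (σ_mod_lt p') (h2.symm.trans h2')
        refine ⟨?_, h6⟩
        rw [← Nat.div_add_mod (p / P.m) q, ← Nat.div_add_mod (p' / P.m) q, h5, ← h1, h1']
      · obtain ⟨h1, h2, h3, h4⟩ := extσ_of_lt (s := s) h0
        obtain ⟨h1', h2', h3', h4'⟩ := extσ_of_ge h0' (hB hp')
        rw [h] at h2
        omega
      · obtain ⟨h1, h2, h3, h4⟩ := extσ_of_ge h0 (hB hp)
        obtain ⟨h1', h2', h3', h4'⟩ := extσ_of_lt (s := s) h0'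
        rw [h] at h2
        omega
      · obtain ⟨h1, h2, h3, h4⟩ := extσ_of_ge h0 (hB hp)
        obtain ⟨h1', h2', h3', h4'⟩ := extσ_of_ge h0' (hB hp')
        rw [h] at h1 h2
        obtain ⟨h5, h6⟩ := mul_add_inj (Nat.mod_lt _ P.k_pos) (Nat.mod_lt _ P.k_pos)
          (Nat.add_left_cancel (h2.symm.trans h2'))
        refine ⟨by omega, ?_⟩
        rw [← Nat.div_add_mod (P.σ (p % P.m)) P.k, ← Nat.div_add_mod (P.σ (p' % P.m)) P.k, h6,
          ← h1, h1']
    have h1 := P.σ_bijOn.injOn (Nat.mod_lt p P.m_pos) (Nat.mod_lt p' P.m_pos) key.2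
    rw [← Nat.div_add_mod p P.m, ← Nat.div_add_mod p' P.m, h1, key.1]

theorem extτ_bijOn (n : ℕ) : Set.BijOn P.extτ (Set.Iio (P.m * n)) (Set.Iio (P.m * n)) := by
  refine bijOn_Iio_of_injOn (fun p hp => ?_) fun p hp p' hp' h => ?_
  · rw [Set.mem_Iio, mul_comm]
    exact mul_add_lt (Nat.div_lt_of_lt_mul hp) (τ_mod_lt p)
  · obtain ⟨h1, h2⟩ := mul_add_inj (τ_mod_lt p) (τ_mod_lt p') h
    have h3 := P.τ_bijOn.injOn (Nat.mod_lt p P.m_pos) (Nat.mod_lt p' P.m_pos) h2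
    rw [← Nat.div_add_mod p P.m, ← Nat.div_add_mod p' P.m, h1, h3]

/-- The extension of `P` in which the first order is cut into intervals of length
`k' = q * m + k * s`. -/
def ext (P : Block) (q s : ℕ) (hk : 0 < q * P.m + P.k * s) : Block where
  k := q * P.m + P.k * s
  l := P.l
  m := P.m * (P.l * q + s)
  σ := P.extσ q s
  τ := P.extτ
  k_pos := hk
  l_pos := P.l_pos
  m_eq := ext_m_eq
  σ_bijOn := extσ_bijOn
  τ_bijOn := extτ_bijOn _

/-- The exceptional copies in `Block.ext`: the distributed ones, and the last intact copy in each
interval of length `k'`. -/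
def extBad (P : Block) (q s : ℕ) : Finset ℕ :=
  Finset.Ico (P.l * q) (P.l * q + s) ∪ (Finset.range P.l).image fun j => q * j + (q - 1)

theorem card_extBad_le : (P.extBad q s).card ≤ s + P.l := by
  refine (Finset.card_union_le _ _).trans (add_le_add (by simp) ?_)
  exact Finset.card_image_le.trans (by simp)

theorem of_notMem_extBad {B : ℕ} (h : B ∉ P.extBad q s) (hB : B < P.l * q + s) :
    B + 1 < P.l * q ∧ B % q + 1 < q := by
  simp only [extBad, Finset.mem_union, Finset.mem_Ico, Finset.mem_image, Finset.mem_range,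
    not_or, not_and, not_exists] at h
  have h1 : B < P.l * q := by omega
  have hq : 0 < q := Nat.pos_of_ne_zero fun h0 => by simp [h0] at h1
  have h2 : B / q < P.l := (Nat.div_lt_iff_lt_mul hq).2 h1
  have h3 := h.2 (B / q) h2
  have h4 := Nat.div_add_mod B q
  have h5 := Nat.mod_lt B hq
  have h6 : B % q + 1 < q := by omega
  refine ⟨?_, h6⟩
  have h7 := mul_add_lt h2 h6
  rw [mul_comm (B / q)] at h7
  omega

theorem extσ_mod_mod {p : ℕ} (hp : p < P.m * (P.l * q + s)) (h : p / P.m ∉ P.extBad q s) :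
    P.extσ q s p % (q * P.m + P.k * s) % P.m = P.σ (p % P.m) := by
  have h1 := of_notMem_extBad h (Nat.div_lt_of_lt_mul hp)
  rw [(extσ_of_lt (by omega)).2.1, mul_comm, Nat.mul_add_mod, Nat.mod_eq_of_lt (σ_mod_lt p)]

theorem ext_extends (hk : 0 < q * P.m + P.k * s) (h : 1 < P.l * q + s) :
    P.Extends (P.ext q s hk) (P.extBad q s) := by
  have hkm : P.k ∣ P.m := ⟨P.l, P.m_eq⟩
  have hlm : P.l ∣ P.m := ⟨P.k, by rw [P.m_eq, mul_comm]⟩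
  have hkk : P.k ∣ q * P.m + P.k * s := (hkm.mul_left q).add (dvd_mul_right _ _)
  have hlt : ∀ {B}, P.m * B < P.m * (P.l * q + s) → B < P.l * q + s := fun h =>
    lt_of_mul_lt_mul_left h (Nat.zero_le _)
  have hdiv : ∀ {B r}, r < P.m → (P.m * B + r) / P.m = B ∧ (P.m * B + r) % P.m = r := by
    intro B r hr
    rw [Nat.mul_add_div P.m_pos, Nat.div_eq_of_lt hr, Nat.mul_add_mod, Nat.mod_eq_of_lt hr]
    simp
  refine ⟨hkk, dvd_refl _, ?_, dvd_mul_right _ _, fun p hp => ?_, fun p hp => ?_,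
    fun B hB hB' => ?_, fun B hB hB' => ?_, fun B hB hB' => ?_⟩
  · change P.m < P.m * (P.l * q + s)
    exact lt_mul_of_one_lt_right P.m_pos h
  · change P.extσ q s p ≡ _ [MOD P.k]
    unfold extσ
    split_ifs
    · have h1 : P.k ∣ p / P.m / q * (q * P.m + P.k * s) + p / P.m % q * P.m :=
        (hkk.mul_left _).add (hkm.mul_left _)
      rw [← add_assoc]
      simpa using ((Nat.modEq_zero_iff_dvd.2 h1).add_right (P.σ (p % P.m)))
    · have h1 : P.k ∣ P.σ (p % P.m) / P.k * (q * P.m + P.k * s) +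
          (q * P.m + (p / P.m - P.l * q) * P.k) :=
        (hkk.mul_left _).add ((hkm.mul_left _).add (dvd_mul_left _ _))
      rw [← add_assoc (q * P.m), ← add_assoc]
      have h2 := ((Nat.modEq_zero_iff_dvd.2 h1).add_right (P.σ (p % P.m) % P.k))
      rw [zero_add] at h2
      exact h2.trans (Nat.mod_modEq _ _)
  · change p / P.m * P.m + P.τ (p % P.m) ≡ _ [MOD P.l]
    simpa using (Nat.modEq_zero_iff_dvd.2 (hlm.mul_left (p / P.m))).add_right (P.τ (p % P.m))
  · have := of_notMem_extBad hB (hlt hB')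
    exact Nat.mul_le_mul_left _ (by omega)
  · obtain ⟨h1, h2⟩ := of_notMem_extBad hB (hlt hB')
    have hq : 0 < q := by omega
    refine ⟨B / q * (q * P.m + P.k * s) + B % q * P.m, fun r hr => ?_⟩
    change P.extσ q s _ = _ ∧ P.extσ q s _ = _
    unfold extσ
    rw [(hdiv hr).1, (hdiv hr).2, (hdiv hr).1, (hdiv hr).2, if_pos (by omega), if_pos h1]
    have h3 : B + 1 = q * (B / q) + (B % q + 1) := by
      have := Nat.div_add_mod B q
      omega
    have h4 : (B + 1) / q = B / q := by
      rw [h3, Nat.mul_add_div hq, Nat.div_eq_of_lt h2, add_zero]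
    have h5 : (B + 1) % q = B % q + 1 := by
      rw [h3, Nat.mul_add_mod, Nat.mod_eq_of_lt h2]
    rw [h4, h5]
    constructor <;> ring
  · refine ⟨P.m * B, fun r hr => ?_⟩
    change P.extτ _ = _ ∧ P.extτ _ = _
    unfold extτ
    rw [(hdiv hr).1, (hdiv hr).2, (hdiv hr).1, (hdiv hr).2]
    constructor <;> ring

end Block

/-! ### Alternating extensions at small cost -/

theorem Sublinear.eventually_le {ω : ℕ → ℝ≥0} (h : Sublinear ω) {η : ℝ≥0} (hη : 0 < η) :
    ∀ᶠ n : ℕ in atTop, ω n + 1 ≤ η * n := by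
  have h1 : Tendsto (fun n : ℕ => (ω n : ℝ) / n + 1 / n) atTop (𝓝 0) := by
    simpa using Tendsto.add h tendsto_one_div_atTop_nhds_zero_nat
  filter_upwards [h1.eventually_lt_const (show (0 : ℝ) < η from hη), eventually_gt_atTop 0]
    with n hn hn0
  have hn0' : (0 : ℝ) < n := by exact_mod_cast hn0
  rw [← add_div, div_lt_iff₀ hn0'] at hn
  exact_mod_cast hn.le

theorem eventually_k_mul {p : ℕ → Prop} (h : ∀ᶠ n in atTop, p n) (a : OdometerSeq) {l : ℕ}
    (hl : 0 < l) : ∀ᶠ i in atTop, p (a.k i * l) :=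
  (a.strictMono.tendsto_atTop.atTop_mul_const' hl).eventually h

/-- The cost of an extension with exceptional copies `bad` is small: `ω Q.m + 1` times the
proportion of the exceptional points is at most `e`, and `ω (2 * Q.m) + 1` times the proportion of the last
points is at most `e'`.  The summand `1` makes these proportions summable even where `ω`
vanishes. -/
structure Block.CostLE (P Q : Block) (bad : Finset ℕ) (ω : ℕ → ℝ≥0) (e e' : ℝ≥0) : Prop where
  bad_le : (ω Q.m + 1) * (bad.card * P.m : ℕ) ≤ e * Q.m
  last_le : ω (2 * Q.m) + 1 ≤ e' * Q.m

/-- A block can be extended so that the first order is cut into intervals of length `a_i` for some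
large `i`, at small cost: the length `P.m * 2 * P.l` of the exceptional copies does not depend on
`i`, and `ω` is sublinear. -/
theorem Block.exists_extends (P : Block) (a : OdometerSeq) (ha : ∃ i, P.k ∣ a.k i) (n : ℕ)
    {ω : ℕ → ℝ≥0} (hω : Sublinear ω) {e e' : ℝ≥0} (he : 0 < e) (he' : 0 < e') :
    ∃ (Q : Block) (bad : Finset ℕ), P.Extends Q bad ∧ P.CostLE Q bad ω e e' ∧ Q.l = P.l ∧
      (∃ i, n ≤ i ∧ Q.k = a.k i) ∧
      ∀ p < Q.m, p / P.m ∉ bad → Q.σ p % Q.k % P.m = P.σ (p % P.m) := by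
  obtain ⟨i₀, hi₀⟩ := ha
  -- There are at most `2 * P.l` exceptional copies, whatever the size of `Q`.
  let C : ℝ≥0 := (2 * P.l * P.m : ℕ)
  have hC : 0 < C := by
    have := P.m_pos
    have := P.l_pos
    exact Nat.cast_pos.2 (by positivity)
  have h2 : ∀ᶠ N : ℕ in atTop, ω (2 * N) + 1 ≤ e' / 2 * (2 * N : ℕ) :=
    (tendsto_id.const_mul_atTop' (by norm_num : 0 < 2)).eventually
      (hω.eventually_le (half_pos he'))
  obtain ⟨i, h1, h2, hi₀', hn, hm⟩ :=
    ((eventually_k_mul (hω.eventually_le (div_pos he hC)) a P.l_pos).and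
      ((eventually_k_mul h2 a P.l_pos).and ((eventually_ge_atTop i₀).and
        ((eventually_ge_atTop n).and (eventually_gt_atTop P.m))))).exists
  replace hm : P.m < a.k i := hm.trans_le (a.le_k i)
  obtain ⟨s, hs⟩ : P.k ∣ a.k i % P.m :=
    (Nat.dvd_mod_iff ⟨P.l, P.m_eq⟩).2 (hi₀.trans (a.dvd_of_le hi₀'))
  have hsl : s < P.l := by
    have h3 := Nat.mod_lt (a.k i) P.m_pos
    rw [hs, P.m_eq] at h3
    exact lt_of_mul_lt_mul_left h3 (Nat.zero_le _)
  have hk : a.k i / P.m * P.m + P.k * s = a.k i := by rw [← hs, Nat.div_add_mod']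
  have hk0 : 0 < a.k i / P.m * P.m + P.k * s := by rw [hk]; exact a.pos i
  have hext : (P.ext (a.k i / P.m) s hk0).m = a.k i * P.l := by
    rw [Block.m_eq]
    exact congrArg (· * P.l) hk
  have hlt : 1 < P.l * (a.k i / P.m) + s := by
    have h3 : P.m * 1 < P.m * (P.l * (a.k i / P.m) + s) := by
      rw [Block.ext_m_eq, hk, mul_one]
      exact hm.trans_le (Nat.le_mul_of_pos_right _ P.l_pos)
    exact lt_of_mul_lt_mul_left h3 (Nat.zero_le _)
  refine ⟨P.ext (a.k i / P.m) s hk0, P.extBad (a.k i / P.m) s, Block.ext_extends hk0 hlt,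
    ⟨?_, ?_⟩, rfl, ⟨i, hn, hk⟩, fun p hp hp' => Block.extσ_mod_mod hp hp'⟩
  · rw [hext]
    have h3 : (((P.extBad (a.k i / P.m) s).card * P.m : ℕ) : ℝ≥0) ≤ C := by
      have := P.card_extBad_le (q := a.k i / P.m) (s := s)
      exact Nat.cast_le.2 (Nat.mul_le_mul_right _ (by omega))
    calc _ ≤ e / C * (a.k i * P.l : ℕ) * C := mul_le_mul' h1 h3
      _ = e * (a.k i * P.l : ℕ) := by
        field_simp
  · rw [hext]
    refine h2.trans_eq ?_
    push_cast
    field_simp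

/-- A sequence of blocks, where the first and the second order are extended in turn. -/
theorem exists_block_seq (a b : OdometerSeq) {ω : ℕ → ℝ≥0} (hω : Sublinear ω) {ε : ℕ → ℝ≥0}
    (hε : ∀ n, 0 < ε n) :
    ∃ (P : ℕ → Block) (bad : ℕ → Finset ℕ),
      (∀ p, (P 0).σ p = p ∧ (P 0).τ p = p) ∧ ω (2 * (P 0).m) + 1 ≤ ε 0 * (P 0).m ∧
      (∀ n, (∃ i, (P n).k ∣ a.k i) ∧ ∃ i, (P n).l ∣ b.k i) ∧
      (∀ n, (P n).Extends (P (n + 1)) (bad n)) ∧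
      (∀ n, (P n).CostLE (P (n + 1)) (bad n) ω (ε n) (ε (n + 1))) ∧
      (∀ n, Even n → (∃ i, n ≤ i ∧ (P (n + 1)).l = b.k i) ∧
        ∀ p < (P (n + 1)).m, p / (P n).m ∉ bad n →
          (P (n + 1)).τ p % (P (n + 1)).l % (P n).m = (P n).τ (p % (P n).m)) ∧
      (∀ n, ¬ Even n → (∃ i, n ≤ i ∧ (P (n + 1)).k = a.k i) ∧
        ∀ p < (P (n + 1)).m, p / (P n).m ∉ bad n →
          (P (n + 1)).σ p % (P (n + 1)).k % (P n).m = (P n).σ (p % (P n).m)) := by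
  let S := {P : Block // (∃ i, P.k ∣ a.k i) ∧ ∃ i, P.l ∣ b.k i}
  have step : ∀ (n : ℕ) (P : S), ∃ (Q : S) (bad : Finset ℕ), P.1.Extends Q.1 bad ∧
      P.1.CostLE Q.1 bad ω (ε n) (ε (n + 1)) ∧
      (Even n → (∃ i, n ≤ i ∧ Q.1.l = b.k i) ∧
        ∀ p < Q.1.m, p / P.1.m ∉ bad → Q.1.τ p % Q.1.l % P.1.m = P.1.τ (p % P.1.m)) ∧
      (¬ Even n → (∃ i, n ≤ i ∧ Q.1.k = a.k i) ∧
        ∀ p < Q.1.m, p / P.1.m ∉ bad → Q.1.σ p % Q.1.k % P.1.m = P.1.σ (p % P.1.m)) := by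
    rintro n ⟨P, hPa, hPb⟩
    by_cases hn : Even n
    · obtain ⟨Q, bad, h1, h2, h3, ⟨i, hi, hQi⟩, h5⟩ :=
        P.swap.exists_extends b hPb n hω (hε n) (hε (n + 1))
      exact ⟨⟨Q.swap, by rw [show Q.swap.k = P.k from h3]; exact hPa, ⟨i, hQi.dvd⟩⟩, bad, h1.swap,
        ⟨h2.bad_le, h2.last_le⟩, fun _ => ⟨⟨i, hi, hQi⟩, h5⟩, fun h => absurd hn h⟩
    · obtain ⟨Q, bad, h1, h2, h3, ⟨i, hi, hQi⟩, h5⟩ :=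
        P.exists_extends a hPa n hω (hε n) (hε (n + 1))
      exact ⟨⟨Q, ⟨i, hQi.dvd⟩, by rw [h3]; exact hPb⟩, bad, h1, h2, fun h => absurd h hn,
        fun _ => ⟨⟨i, hi, hQi⟩, h5⟩⟩
  choose f bad hf using step
  -- The construction starts with a single long interval on which the two orders coincide.
  have h2 : ∀ᶠ N : ℕ in atTop, ω (2 * N) + 1 ≤ ε 0 / 2 * (2 * N : ℕ) :=
    (tendsto_id.const_mul_atTop' (by norm_num : 0 < 2)).eventually
      (hω.eventually_le (half_pos (hε 0)))
  obtain ⟨i, hi⟩ := (a.strictMono.tendsto_atTop.eventually h2).exists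
  let P₀ : S := ⟨⟨a.k i, 1, a.k i, id, id, a.pos i, one_pos, (mul_one _).symm,
    Set.bijOn_id _, Set.bijOn_id _⟩, ⟨i, dvd_refl _⟩, ⟨0, one_dvd _⟩⟩
  let P : ℕ → S := fun n => Nat.rec P₀ (fun n P => f n P) n
  refine ⟨fun n => (P n).1, fun n => bad n (P n), fun p => ⟨rfl, rfl⟩, ?_, fun n => (P n).2,
    fun n => (hf n (P n)).1, fun n => (hf n (P n)).2.1, fun n => (hf n (P n)).2.2.1,
    fun n => (hf n (P n)).2.2.2⟩
  refine hi.trans_eq ?_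
  change _ = ε 0 * (a.k i : ℕ)
  push_cast
  field_simp

theorem mul_measure_le_of_le {x y e : ℝ≥0} {k : ℕ} (h : (x + 1) * y ≤ e * k)
    {p : ℝ≥0∞} (hp : p ≤ y / k) : ((x : ℝ≥0∞) + 1) * p ≤ e := by
  calc ((x : ℝ≥0∞) + 1) * p ≤ (x + 1) * (y / k) := by gcongr
    _ = (x + 1) * y / k := by rw [mul_div_assoc]
    _ ≤ e := ENNReal.div_le_of_le_mul (by exact_mod_cast h)

theorem exists_measureIso_omegaNorm_lt (a b : OdometerSeq) {ω : ℕ → ℝ≥0} (hmono : Monotone ω)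
    (hω : Sublinear ω) {δ : ℝ≥0} (hδ : 0 < δ) :
    ∃ φ : MeasureIso a.measure b.measure, φ.IsOmegaOrbitEquivalence ω ω ∧
      omegaNorm a.measure ω (cocycle φ.toFun 1) < (ω 1 : ℝ≥0∞) + (δ : ℝ≥0∞) ∧
      omegaNorm b.measure ω (cocycle φ.invFun 1) < (ω 1 : ℝ≥0∞) + (δ : ℝ≥0∞) := by
  obtain ⟨ε, hε, hεδ⟩ := ENNReal.exists_pos_sum_of_countable
    (ε := (δ / 2 : ℝ≥0)) (by simpa using hδ.ne') ℕ
  obtain ⟨P, bad, h0, h0last, hdvd, hext, hcost, heven, hodd⟩ := exists_block_seq a b hω hε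
  let m : OdometerSeq := ⟨fun n => (P n).m, strictMono_nat_of_lt_succ fun n => (hext n).m_lt,
    fun n => (hext n).m_dvd⟩
  let c : Coding m a :=
    { k := fun n => (P n).k
      σ := fun n => (P n).σ
      bijOn := fun n => (P n).σ_bijOn
      k_dvd := fun n => (hext n).k_dvd
      k_dvd_m := fun n => ⟨(P n).l, (P n).m_eq⟩
      cofinal := fun i => by
        obtain ⟨j, hj, hPj⟩ := (hodd (2 * i + 1) (by simp)).1
        exact ⟨_, by rw [hPj]; exact a.dvd_of_le (by omega)⟩
      modEq := fun n => (hext n).σ_modEq }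
  let d : Coding m b :=
    { k := fun n => (P n).l
      σ := fun n => (P n).τ
      bijOn := fun n => (P n).τ_bijOn
      k_dvd := fun n => (hext n).l_dvd
      k_dvd_m := fun n => ⟨(P n).k, by rw [mul_comm]; exact (P n).m_eq⟩
      cofinal := fun i => by
        obtain ⟨j, hj, hPj⟩ := (heven (2 * i) (by simp)).1
        exact ⟨_, by rw [hPj]; exact b.dvd_of_le (by omega)⟩
      modEq := fun n => (hext n).τ_modEq }
  have hlast : ∀ n, ω (2 * m.k n) + 1 ≤ ε n * m.k n := by
    rintro (_ | n)
    exacts [h0last, (hcost n).last_le]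
  have hlast' : ∀ {a' : OdometerSeq} (e : Coding m a') (n : ℕ),
      ((ω (2 * m.k n) : ℝ≥0∞) + 1) * m.measure (e.lastSet n) ≤ ε n := fun e n =>
    mul_measure_le_of_le (y := 1) (by simpa using hlast n)
      (by simpa using e.measure_lastSet_le n)
  refine exists_measureIso_of_codings c d (bad := bad) (ε := fun n => ε n) hmono ?_
    (fun p _ => h0 p) (fun n => (hext n).le_of_notMem) (fun n => (hext n).σ_translatesAt)
    (fun n => (hext n).τ_translatesAt) (fun n => (hdvd n).1) (fun n => (hdvd n).2) ?_ ?_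
    (fun n => mul_measure_le_of_le (hcost n).bad_le
      (by simpa using measure_badSet_le (m := m) bad n)) (hlast' c) (hlast' d)
  · rw [ENNReal.tsum_mul_left]
    calc 2 * ∑' n, (ε n : ℝ≥0∞) < 2 * (δ / 2 : ℝ≥0) :=
          ENNReal.mul_lt_mul_right (by norm_num) (by norm_num) hεδ
      _ = δ := by
        rw [← ENNReal.coe_ofNat, ← ENNReal.coe_mul, mul_div_cancel₀ _ two_ne_zero]
  · exact frequently_atTop.2 fun n => ⟨2 * n + 1, by omega, (hodd (2 * n + 1) (by simp)).2⟩
  · exact frequently_atTop.2 fun n => ⟨2 * n, by omega, (heven (2 * n) (by simp)).2⟩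

end QOE

theorem theoremA (a b : QOE.OdometerSeq) :
    (∀ ω : ℕ → ℝ≥0, Monotone ω → QOE.Sublinear ω →
      QOE.OmegaOrbitEquivalent a.measure b.measure ω ∧
      ∀ δ : ℝ≥0, 0 < δ →
        ∃ φ : QOE.MeasureIso a.measure b.measure,
          φ.IsOmegaOrbitEquivalence ω ω ∧
          QOE.omegaNorm a.measure ω (QOE.cocycle φ.toFun 1) < (ω 1 : ℝ≥0∞) + (δ : ℝ≥0∞) ∧
          QOE.omegaNorm b.measure ω (QOE.cocycle φ.invFun 1) < (ω 1 : ℝ≥0∞) + (δ : ℝ≥0∞)) ∧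
    QOE.SubL1OrbitEquivalent a.measure b.measure := by
  have key : ∀ ω : ℕ → ℝ≥0, Monotone ω → QOE.Sublinear ω →
      QOE.OmegaOrbitEquivalent a.measure b.measure ω := fun ω hmono hω =>
    let ⟨φ, hφ, _⟩ := QOE.exists_measureIso_omegaNorm_lt a b hmono hω one_pos
    ⟨φ, hφ⟩
  exact ⟨fun ω hmono hω => ⟨key ω hmono hω, fun δ hδ =>
    QOE.exists_measureIso_omegaNorm_lt a b hmono hω hδ⟩, key⟩
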